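/- **Setting.** Let $N$ be a ground set of $n$ keys. For a set $U\subseteq N$ and randomness $\rho$, the sketch $S_\rho(U)$ of size $k\ge 1$ is one of the following (all hash values are i.i.d. from a fixed atomless probability law on $\mathbb R$): - *$k$-mins*: $(\min_{x\in U}h_i(x))_{i\in[k]}$ for $k$ hash functions $h_1,\dots,h_k$; - *bottom-$k$*: the $k$ smallest values of $h(x)$, $x\in U$, for one hash function $h$; - *$k$-partition*: $(\min_{x\in U,\,P(x)=i}h(x))_{i\in[k]}$ for one hash function $h$ and an independent uniformly random partition $P:N\to[k]$. *Correct maps.* Let $A=n/16$. Fix $\rho$, a distribution $\mathcal D$ on subsets of $N$, and $\delta\ge 0$. A map $\pi$ from sketches to $[0,1]$ is *correct* for $\mathcal D$ (a correct soft-threshold map) if for every cardinality $c$ that has positive probability under $\mathcal D$, $$\mathbb E_{Q\sim\mathcal D}\big[\pi(S_\rho(Q))\,\big|\,|Q|=c\big]\le\delta\ \text{ if } c<A,\qquad \mathbb E_{Q\sim\mathcal D}\big[\pi(S_\rho(Q))\,\big|\,|Q|=c\big]\ge 1-\delta\ \text{ if } c>2A .$$ *The distribution $\mathcal D_0$.*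 Let $\omega=n/(2A)=8$. Draw $D$ uniformly from $[0,\omega/4]$, then $x$ uniformly from $[\omega/2+D,\ \omega/2+D+\tfrac74\omega]$, put $q=1/x$, and include each key of $N$ in $U$ independently with probability $q$. *The adaptive attacker (Algorithm 4) of size $r$.* Start with the mask $M=\emptyset$ and scores $C[x]=0$ for $x\in N$. In round $i=1,\dots,r$: 1. A query-response algorithm, which may be randomized and may depend arbitrarily on $\rho$ and on the transcript so far (including $M$ and $C$), selects a map $\pi$ that is correct for the distribution of $M\cup U$, $U\sim\mathcal D_0$. If there is no correct map, it reports failure and the attack exits. 2. The attacker samples $U\sim\mathcal D_0$, issues the query $M\cup U$, and receives $Z\sim\mathrm{Bern}[\pi(S_\rho(M\cup U))]$. 3. For the keys $x\in U$, one after the other, $C[x]\gets C[x]+Z$, and if $C[x]\ge \mathrm{median}(C[N\setminus M])+\sqrt{i\log(200nr)/2}$ then $M\gets M\cup\{x\}$. The attacker returns $M$. **Theorem 7.1.** There are absolute constants $c_0>0$, $C>0$ and $p\in\mathbb N$ such that for each of the three sketch types the following holds. Let $k\ge1$, $0<\alpha\le 1$, $0\le\delta\le c_0/\sqrt k$, and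 let $n,r$ be such that $$n\ \ge\ C\,\frac{k\log(kr)}{\alpha},\qquad r\ \ge\ C\,\frac{k^2}{\alpha^2}\,\log^p\!\Big(\frac{kn}{\alpha}+2\Big).$$ Then, against every query-response algorithm, with probability at least $0.99$ (over $\rho$, the samples of the attacker and the responses) the mask $M$ returned by the adaptive attacker of size $r$ satisfies $|M|<\alpha n$ and there is no correct map for the distribution of $M\cup U$, $U\sim\mathcal D_0$. -/

import Mathlib

open MeasureTheory
open scoped ENNReal

noncomputable section

namespace SketchAttack

/-! ### Sketch maps

The ground set of `n` keys is `Fin n`.  Hash values of distinct keys are i.i.d., so the law of the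
hash values on the ground set does not depend on which `n` keys of the universe were picked. -/

/-- The `k`-mins sketch: the minimum over `U` of each of the `k` hash functions
(`⊤` for the empty set). -/
def kMins {k n : ℕ} (h : Fin k → Fin n → ℝ) (U : Finset (Fin n)) : Fin k → WithTop ℝ :=
  fun i => U.inf fun x => (h i x : WithTop ℝ)

/-- The law of the randomness of the `k`-mins sketch: all hash values are i.i.d. with law `ν`. -/
def kMinsLaw (k n : ℕ) (ν : Measure ℝ) : Measure (Fin k → Fin n → ℝ) :=
  Measure.pi fun _ => Measure.pi fun _ => ν

/-- The bottom-`k` sketch: the `k` smallest hash values of keys of `U`, in increasing order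
(all of them if `U` has fewer than `k` keys). -/
def bottomK {n : ℕ} (k : ℕ) (h : Fin n → ℝ) (U : Finset (Fin n)) : List ℝ :=
  ((U.val.map h).sort (· ≤ ·)).take k

/-- The law of the randomness of the bottom-`k` sketch: i.i.d. hash values with law `ν`. -/
def bottomKLaw (n : ℕ) (ν : Measure ℝ) : Measure (Fin n → ℝ) :=
  Measure.pi fun _ => ν

/-- The `k`-partition sketch.  The randomness consists of a partition `ρ.1` of the keys into
`k` parts and of a hash function `ρ.2`; the sketch lists the minimum hash value of each part
(`⊤` if `U` has no key in the part). -/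
def kPartition {k n : ℕ} (ρ : (Fin n → Fin k) × (Fin n → ℝ)) (U : Finset (Fin n)) :
    Fin k → WithTop ℝ :=
  fun i => (U.filter fun x => ρ.1 x = i).inf fun x => (ρ.2 x : WithTop ℝ)

/-- The law of the randomness of the `k`-partition sketch: a uniformly random partition and,
independently, i.i.d. hash values with law `ν`. -/
def kPartitionLaw (k n : ℕ) (ν : Measure ℝ) : Measure ((Fin n → Fin k) × (Fin n → ℝ)) :=
  (ProbabilityTheory.uniformOn (Set.univ : Set (Fin n → Fin k))).prod (Measure.pi fun _ => ν)

/-! ### The query distribution -/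

/-- The soft threshold `A = n / 16`. -/
def threshold (n : ℕ) : ℝ := n / 16

/-- The reference inverse rate `ω = n / (2 A)`, which is `8`. -/
def omega : ℝ := 8

theorem omega_eq {n : ℕ} (hn : n ≠ 0) : omega = n / (2 * threshold n) := by
  have : (n : ℝ) ≠ 0 := by exact_mod_cast hn
  unfold omega threshold
  field_simp
  norm_num

/-- The expectation of `g q` for the random sampling rate `q = 1 / x`, where `D` is uniform on
`[0, ω / 4]` and, given `D`, `x` is uniform on `[ω / 2 + D, ω / 2 + D + 7 ω / 4]`. -/
def rateExp (g : ℝ → ℝ) : ℝ :=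
  4 / omega * ∫ D in (0 : ℝ)..(omega / 4),
    4 / (7 * omega) * ∫ x in (omega / 2 + D)..(omega / 2 + D + 7 / 4 * omega), g (1 / x)

/-- The probability that `U` is sampled: a random rate `q` is drawn, then each of the `n` keys is
included independently with probability `q`. -/
def sampleWeight {n : ℕ} (U : Finset (Fin n)) : ℝ :=
  rateExp fun q => q ^ U.card * (1 - q) ^ (n - U.card)

theorem rateExp_congr {f g : ℝ → ℝ} (h : ∀ q, 0 < q → q ≤ 1 → f q = g q) :
    rateExp f = rateExp g := by
  unfold rateExp omega
  congr 1
  apply intervalIntegral.integral_congr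
  intro D hD
  rw [Set.uIcc_of_le (by norm_num)] at hD
  simp only
  congr 1
  apply intervalIntegral.integral_congr
  intro x hx
  rw [Set.uIcc_of_le (by linarith)] at hx
  have hx1 : (1 : ℝ) ≤ x := by linarith [hx.1, hD.1]
  exact h _ (by positivity) (by rw [div_le_one (by linarith)]; exact hx1)

theorem rateExp_nonneg {g : ℝ → ℝ} (h : ∀ q, 0 < q → q ≤ 1 → 0 ≤ g q) : 0 ≤ rateExp g := by
  unfold rateExp omega
  refine mul_nonneg (by norm_num) (intervalIntegral.integral_nonneg (by norm_num) ?_)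
  intro D hD
  refine mul_nonneg (by norm_num) (intervalIntegral.integral_nonneg (by linarith) ?_)
  intro x hx
  have hx1 : (1 : ℝ) ≤ x := by linarith [hx.1, hD.1]
  exact h _ (by positivity) (by rw [div_le_one (by linarith)]; exact hx1)

theorem rateExp_one : rateExp (fun _ => 1) = 1 := by
  unfold rateExp omega
  simp only [intervalIntegral.integral_const, add_sub_cancel_left, smul_eq_mul]
  norm_num

theorem rateExp_sum {ι : Type} (s : Finset ι) (g : ι → ℝ → ℝ) (hg : ∀ i, Continuous (g i)) :
    rateExp (fun q => ∑ i ∈ s, g i q) = ∑ i ∈ s, rateExp (g i) := by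
  have key : ∀ f : ℝ → ℝ, rateExp f = 4 / omega * ∫ D in (0 : ℝ)..(omega / 4),
      4 / (7 * omega) * ∫ x in (omega / 2 + D)..(omega / 2 + D + 7 / 4 * omega),
        f (1 / max x 1) := by
    intro f
    unfold rateExp omega
    congr 1
    apply intervalIntegral.integral_congr
    intro D hD
    rw [Set.uIcc_of_le (by norm_num)] at hD
    simp only
    congr 1
    apply intervalIntegral.integral_congr
    intro x hx
    rw [Set.uIcc_of_le (by linarith)] at hx
    have hx1 : (1 : ℝ) ≤ x := by linarith [hx.1, hD.1]
    simp only [max_eq_left hx1]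
  have hc : ∀ i, Continuous fun x : ℝ => g i (1 / max x 1) := by
    intro i
    refine (hg i).comp (continuous_const.div (by fun_prop) ?_)
    intro x
    have : (1 : ℝ) ≤ max x 1 := le_max_right _ _
    linarith
  have hc2 : ∀ i, Continuous fun D : ℝ =>
      ∫ x in (omega / 2 + D)..(omega / 2 + D + 7 / 4 * omega), g i (1 / max x 1) := by
    intro i
    have e : ∀ D : ℝ, ∫ x in (omega / 2 + D)..(omega / 2 + D + 7 / 4 * omega), g i (1 / max x 1)
        = (∫ x in (0 : ℝ)..(omega / 2 + D + 7 / 4 * omega), g i (1 / max x 1))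
          - ∫ x in (0 : ℝ)..(omega / 2 + D), g i (1 / max x 1) := by
      intro D
      rw [intervalIntegral.integral_interval_sub_left] <;>
        exact (hc i).intervalIntegrable _ _
    simp_rw [e]
    have hp : Continuous fun b : ℝ => ∫ x in (0 : ℝ)..b, g i (1 / max x 1) :=
      intervalIntegral.continuous_primitive (fun a b => (hc i).intervalIntegrable a b) 0
    exact (hp.comp (by fun_prop : Continuous fun D : ℝ => omega / 2 + D + 7 / 4 * omega)).sub
      (hp.comp (by fun_prop : Continuous fun D : ℝ => omega / 2 + D))
  simp_rw [key]
  rw [← Finset.mul_sum]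
  congr 1
  rw [← intervalIntegral.integral_finsetSum]
  · apply intervalIntegral.integral_congr
    intro D _
    simp only
    rw [intervalIntegral.integral_finsetSum, Finset.mul_sum]
    intro i _
    exact (hc i).intervalIntegrable _ _
  · intro i _
    exact (continuous_const.mul (hc2 i)).intervalIntegrable _ _

theorem sampleWeight_nonneg {n : ℕ} (U : Finset (Fin n)) : 0 ≤ sampleWeight U :=
  rateExp_nonneg fun q h0 h1 => mul_nonneg (pow_nonneg h0.le _) (pow_nonneg (by linarith) _)

theorem sum_sampleWeight (n : ℕ) : ∑ U : Finset (Fin n), sampleWeight U = 1 := by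
  unfold sampleWeight
  rw [← rateExp_sum _ _ (fun U => by fun_prop)]
  refine Eq.trans ?_ rateExp_one
  congr 1
  funext q
  simpa using Fintype.sum_pow_mul_eq_add_pow (Fin n) q (1 - q)

/-- The distribution `𝒟₀` of the random set `U`. -/
def baseDist (n : ℕ) : PMF (Finset (Fin n)) :=
  PMF.ofFintype (fun U => ENNReal.ofReal (sampleWeight U)) (by
    rw [← ENNReal.ofReal_sum_of_nonneg fun U _ => sampleWeight_nonneg U, sum_sampleWeight,
      ENNReal.ofReal_one])

/-- The distribution of the query `M ∪ U` with `U ∼ 𝒟₀`. -/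
def queryDist {n : ℕ} (M : Finset (Fin n)) : PMF (Finset (Fin n)) :=
  (baseDist n).map fun U => M ∪ U

/-! ### Correct maps -/

/-- The probability that a query drawn from `D` has cardinality `c`. -/
def cardProb {n : ℕ} (D : PMF (Finset (Fin n))) (c : ℕ) : ℝ :=
  ∑ Q : Finset (Fin n) with Q.card = c, (D Q).toReal

/-- The conditional expectation of `f Q`, for `Q` drawn from `D`, given that `Q` has cardinality
`c` (meaningful when `cardProb D c` is positive). -/
def condExp {n : ℕ} (D : PMF (Finset (Fin n))) (c : ℕ) (f : Finset (Fin n) → ℝ) : ℝ :=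
  (∑ Q : Finset (Fin n) with Q.card = c, (D Q).toReal * f Q) / cardProb D c

/-- The map `π` from sketches to probabilities of answering `1` is correct for the soft threshold
`A`, the error `δ`, the query distribution `D` and the (fixed) sketch map `S`. -/
def IsCorrect {n : ℕ} {Sk : Type} (S : Finset (Fin n) → Sk) (A δ : ℝ)
    (D : PMF (Finset (Fin n))) (π : Sk → unitInterval) : Prop :=
  ∀ c : ℕ, 0 < cardProb D c →
    ((c : ℝ) < A → condExp D c (fun Q => (π (S Q) : ℝ)) ≤ δ) ∧
    (2 * A < (c : ℝ) → 1 - δ ≤ condExp D c (fun Q => (π (S Q) : ℝ)))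

/-- There is a correct map for the query distribution `M ∪ U`, `U ∼ 𝒟₀`, with `A = n / 16`. -/
def CorrectMapExists {n : ℕ} {Sk : Type} (S : Finset (Fin n) → Sk) (δ : ℝ)
    (M : Finset (Fin n)) : Prop :=
  ∃ π : Sk → unitInterval, IsCorrect S (threshold n) δ (queryDist M) π

/-! ### The adaptive attacker -/

/-- The median of a multiset of natural numbers (the mean of the two middle elements when there
is an even number of them). -/
def median (s : Multiset ℕ) : ℝ :=
  ((((s.sort (· ≤ ·)).getD ((Multiset.card s - 1) / 2) 0 : ℕ) : ℝ) +
    (((s.sort (· ≤ ·)).getD (Multiset.card s / 2) 0 : ℕ) : ℝ)) / 2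

/-- The state of the attacker: its mask and the scores of the keys. -/
structure AttackState (n : ℕ) where
  mask : Finset (Fin n)
  score : Fin n → ℕ

/-- Process one key `x` of the set `U` in a round with response `Z`: increase its score by `Z`, and
add it to the mask if the score is at least the current median score of the unmasked keys plus
`lam`. -/
def scoreKey {n : ℕ} (lam : ℝ) (Z : Bool) (s : AttackState n) (x : Fin n) : AttackState n :=
  let C := Function.update s.score x (s.score x + Z.toNat)
  { score := C
    mask := if median ((s.maskᶜ).val.map C) + lam ≤ (C x : ℝ) then insert x s.mask else s.mask }

/-- Round number `i` of an attack of size `r`, with sampled set `U` and response `Z`: the keys of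
`U` are processed one after the other. -/
def scoreRound {n : ℕ} (r i : ℕ) (U : Finset (Fin n)) (Z : Bool) (s : AttackState n) :
    AttackState n :=
  (U.sort (· ≤ ·)).foldl (scoreKey (Real.sqrt (i * Real.log (200 * n * r) / 2)) Z) s

/-- The sampled sets and the responses of the rounds so far, latest round first. -/
abbrev Transcript (n : ℕ) := List (Finset (Fin n) × Bool)

/-- The state of the attacker (of size `r`) after the rounds recorded in a transcript. -/
def attackState {n : ℕ} (r : ℕ) : Transcript n → AttackState n
  | [] => { mask := ∅, score := fun _ => 0 }
  | (U, Z) :: t => scoreRound r (t.length + 1) U Z (attackState r t)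

/-- The mask of the attacker after the rounds recorded in a transcript. -/
def maskOf {n : ℕ} (r : ℕ) (t : Transcript n) : Finset (Fin n) := (attackState r t).mask

/-! ### Query response and the interaction -/

/-- A query response algorithm against the attack of size `r`, for a fixed sketch map `S`.
In each round it selects a map from sketches to probabilities, as an arbitrary function of the
transcript (which determines the state of the attacker and the query distribution); the map must be
correct whenever a correct map exists. -/
structure QueryResponder {n : ℕ} {Sk : Type} (S : Finset (Fin n) → Sk) (δ : ℝ) (r : ℕ) where
  select : Transcript n → Sk → unitInterval
  correct : ∀ t : Transcript n, CorrectMapExists S δ (maskOf r t) →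
    IsCorrect S (threshold n) δ (queryDist (maskOf r t)) (select t)

/-- The Bernoulli distribution on `Bool` with probability `p` of `true`. -/
def bern (p : unitInterval) : PMF Bool :=
  PMF.ofFintype (fun b => ENNReal.ofReal (if b then (p : ℝ) else 1 - p)) (by
    rw [Fintype.sum_bool]
    simp only [if_true, Bool.false_eq_true, if_false]
    rw [← ENNReal.ofReal_add p.2.1 (by linarith [p.2.2])]
    simp)

open Classical in
/-- One round after the transcript `t`.  If no correct map exists then the query response algorithm
reports failure and the attack exits: nothing is recorded, in this and in later rounds.  Otherwise
`U ∼ 𝒟₀` is sampled, the query is `M ∪ U`, and the response is `1` with the probability given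
by the selected map at the sketch of `M ∪ U`. -/
def attackStep {n : ℕ} {Sk : Type} {S : Finset (Fin n) → Sk} {δ : ℝ} {r : ℕ}
    (qr : QueryResponder S δ r) (t : Transcript n) : PMF (Transcript n) :=
  if CorrectMapExists S δ (maskOf r t) then
    (baseDist n).bind fun U =>
      (bern (qr.select t (S (maskOf r t ∪ U)))).map fun Z => (U, Z) :: t
  else PMF.pure t

/-- The distribution of the transcript after `i` rounds. -/
def attackRun {n : ℕ} {Sk : Type} {S : Finset (Fin n) → Sk} {δ : ℝ} {r : ℕ}
    (qr : QueryResponder S δ r) : ℕ → PMF (Transcript n)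
  | 0 => PMF.pure []
  | i + 1 => (attackRun qr i).bind (attackStep qr)

/-- The probability, for a fixed sketch map `S`, that the mask `M` returned by the attack of size
`r` has fewer than `α n` keys and that there is no correct map for the query distribution
`M ∪ U`, `U ∼ 𝒟₀`. -/
def successProb {n : ℕ} {Sk : Type} {S : Finset (Fin n) → Sk} {δ : ℝ} {r : ℕ} (α : ℝ)
    (qr : QueryResponder S δ r) : ℝ≥0∞ :=
  (attackRun qr r).toOuterMeasure
    {t | ((maskOf r t).card : ℝ) < α * n ∧ ¬ CorrectMapExists S δ (maskOf r t)}

/-- The attack of size `r` succeeds with probability at least `0.99` against every query response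
algorithm, for the sketch maps `sketch ρ` with randomness `ρ` of law `law`.  The algorithm may
depend arbitrarily on `ρ` and on private random coins `ω` that are independent of `ρ`.
For an algorithm that depends on `(ρ, ω)` in a non-measurable way the integral is the lower
integral, so the bound holds in the strongest sense. -/
def AttackSucceeds {n : ℕ} {R Sk : Type} [MeasurableSpace R] (law : Measure R)
    (sketch : R → Finset (Fin n) → Sk) (α δ : ℝ) (r : ℕ) : Prop :=
  ∀ (Ω : Type) [MeasurableSpace Ω] (P : Measure Ω) [IsProbabilityMeasure P]
    (qr : (ρ : R) → Ω → QueryResponder (sketch ρ) δ r),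
    ENNReal.ofReal 0.99 ≤ ∫⁻ z, successProb α (qr z.1 z.2) ∂(law.prod P)

end SketchAttack

end

/-!
The proof works for every fixed value of the randomness of the sketch, so the law of the hash values
plays no role.

*Few keys matter.* There is a set `N₀` of at most `k ℓ` keys, `ℓ ≈ 40 log (k r)`, such that the sketch
of `M ∪ U` with `M ⊆ N₀` depends on `U` only through `U ∩ N₀`, unless `U` misses one of `k` blocks of
`ℓ` keys of low hash value (`exists_determines_kMins`, `exists_determines_bottomK`,
`exists_determines_kPartition`). The sampling rate is at least `1 / 20`, so this happens with
probability at most `k (19 / 20) ^ ℓ`, which is far below `1 / r`.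

*No key outside `N₀` is masked.* As long as `M ⊆ N₀`, the response is almost independent of the keys
outside `N₀`, so their scores are exchangeable. In one round the difference of two such scores is
`1` or `-1` with probability at most `2 E[q (1 - q)] ≤ 0.18`, so its exponential moment is at most
`exp (s ^ 2 / (8 γ))` with `γ = 51 / 50` (`one_add_mul_cosh_sub_one_le`). A masked key outside `N₀`
would exceed about half of the other ones by the margin, so the sum of the exponentials of all
differences would reach a barrier. By Markov's inequality this has probability of order
`n (200 n r) ^ (-γ)` in each round; since `γ > 1`, the sum over the rounds is small when `n r` is large
(`mean_attackRun_not_concentrated_le`). The same potential shows that the scores outside `N₀` differ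
by at most twice the margin, so an unmasked key of `N₀` is ahead of them by at most three margins
(`Concentrated.score_sub_le_of_notMem`).

*The unmasked keys of `N₀` keep gaining.* Given its cardinality the query is uniform, so a correct map
has, at each fixed rate `q`, an expectation `F q` that is close to `0` for `q ≤ 1 / 18` and close to
`1` for `q ≥ 2 / 15` (`IsCorrect.le_binExp`, `IsCorrect.binExp_le`). By Russo's formula the expected
total advantage that the unmasked keys of `N₀` gain in a round is `q (1 - q) F' q`, averaged over the
rate; integration by parts in `x = 1 / q` bounds the average below by a constant
(`le_rateExp_sum_correlation`).

*The attack exits.* Thus, while correct maps exist, the total advantage of the keys of `N₀`, each one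
frozen when it is masked, drifts up at a constant rate, but it is bounded by `|N₀|` times a few
margins, which is of order `k log (k r) √(r log (n r))`. For the given `r` this is much smaller than
`r`, so with high probability the attack has exited before round `r`
(`mean_attackRun_slack_le`, `Determines.le_successProb`).
-/

noncomputable section

namespace SketchAttack

/-! ### Expectations over binomial random sets -/

section BinomialExpectation

/-- The expectation of `g U` when each key is included in `U` independently with probability
`q`. -/
def binExp {n : ℕ} (q : ℝ) (g : Finset (Fin n) → ℝ) : ℝ :=
  ∑ U, q ^ U.card * (1 - q) ^ (n - U.card) * g U

/-- The value `g U` does not depend on whether the key `x` belongs to `U`. -/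
def Ignores {n : ℕ} (g : Finset (Fin n) → ℝ) (x : Fin n) : Prop :=
  ∀ U, g (insert x U) = g U

theorem Ignores.erase {n : ℕ} {g : Finset (Fin n) → ℝ} {x : Fin n} (h : Ignores g x)
    (U : Finset (Fin n)) : g (U.erase x) = g U := by
  by_cases hx : x ∈ U
  · have := h (U.erase x)
    rw [Finset.insert_erase hx] at this
    exact this.symm
  · rw [Finset.erase_eq_of_notMem hx]

/-- The indicator of `x ∈ U`. -/
def ind {n : ℕ} (x : Fin n) (U : Finset (Fin n)) : ℝ := if x ∈ U then 1 else 0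

variable {n : ℕ} {q : ℝ}

theorem binExp_add (g h : Finset (Fin n) → ℝ) :
    binExp q (fun U => g U + h U) = binExp q g + binExp q h := by
  simp only [binExp, mul_add, Finset.sum_add_distrib]

theorem binExp_sub (g h : Finset (Fin n) → ℝ) :
    binExp q (fun U => g U - h U) = binExp q g - binExp q h := by
  simp only [binExp, mul_sub, Finset.sum_sub_distrib]

theorem binExp_mul_left (c : ℝ) (g : Finset (Fin n) → ℝ) :
    binExp q (fun U => c * g U) = c * binExp q g := by
  simp only [binExp, Finset.mul_sum]
  exact Finset.sum_congr rfl fun U _ => by ring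

theorem binExp_sum {ι : Type*} (s : Finset ι) (g : ι → Finset (Fin n) → ℝ) :
    binExp q (fun U => ∑ i ∈ s, g i U) = ∑ i ∈ s, binExp q (g i) := by
  simp only [binExp, Finset.mul_sum]
  rw [Finset.sum_comm]

theorem binExp_const (c : ℝ) : binExp q (fun _ : Finset (Fin n) => c) = c := by
  unfold binExp
  rw [← Finset.sum_mul]
  have := Fintype.sum_pow_mul_eq_add_pow (Fin n) q (1 - q)
  simp only [Fintype.card_fin] at this
  rw [this]; simp

theorem binWeight_nonneg (h0 : 0 ≤ q) (h1 : q ≤ 1) (a b : ℕ) : 0 ≤ q ^ a * (1 - q) ^ b :=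
  mul_nonneg (pow_nonneg h0 _) (pow_nonneg (by linarith) _)

theorem binExp_mono (h0 : 0 ≤ q) (h1 : q ≤ 1) {g h : Finset (Fin n) → ℝ} (hgh : ∀ U, g U ≤ h U) :
    binExp q g ≤ binExp q h :=
  Finset.sum_le_sum fun U _ => mul_le_mul_of_nonneg_left (hgh U) (binWeight_nonneg h0 h1 _ _)

theorem binExp_nonneg (h0 : 0 ≤ q) (h1 : q ≤ 1) {g : Finset (Fin n) → ℝ} (hg : ∀ U, 0 ≤ g U) :
    0 ≤ binExp q g := by
  have := binExp_mono h0 h1 hg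
  rwa [binExp_const] at this

theorem continuous_binExp (g : Finset (Fin n) → ℝ) : Continuous fun q => binExp q g := by
  unfold binExp
  fun_prop

/-- Conditioning on whether the key `x` is included. -/
theorem binExp_resample (x : Fin n) (g : Finset (Fin n) → ℝ) :
    binExp q g = q * binExp q (fun U => g (insert x U)) +
      (1 - q) * binExp q (fun U => g (U.erase x)) := by
  have hx : x ∉ Finset.univ.erase x := by simp
  have hu : (Finset.univ : Finset (Finset (Fin n))) =
      (insert x (Finset.univ.erase x)).powerset := by
    rw [Finset.insert_erase (Finset.mem_univ _), Finset.powerset_univ]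
  unfold binExp
  rw [hu]
  simp only [Finset.sum_powerset_insert hx]
  simp only [← Finset.sum_add_distrib, Finset.mul_sum]
  refine Finset.sum_congr rfl fun t ht => ?_
  have hxt : x ∉ t := fun h => hx (Finset.mem_powerset.1 ht h)
  have hc : t.card + 1 ≤ n := by
    rw [← Finset.card_insert_of_notMem hxt]
    simpa using (insert x t).card_le_univ
  obtain ⟨m, hm⟩ : ∃ m, n - t.card = m + 1 := ⟨n - t.card - 1, by omega⟩
  have hm' : n - (t.card + 1) = m := by omega
  rw [Finset.card_insert_of_notMem hxt, Finset.insert_idem, Finset.erase_insert hxt,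
    Finset.erase_eq_of_notMem hxt, hm, hm']
  ring

theorem binExp_mul_ind_sub {g : Finset (Fin n) → ℝ} {x : Fin n} (h : Ignores g x) :
    binExp q (fun U => g U * (ind x U - q)) = 0 := by
  rw [binExp_resample x]
  simp only [h _, h.erase, ind, Finset.mem_insert_self, Finset.notMem_erase, if_true, if_false]
  have e1 : binExp q (fun U => g U * (1 - q)) = (1 - q) * binExp q g := by
    rw [← binExp_mul_left]; congr 1; funext U; ring
  have e2 : binExp q (fun U => g U * (0 - q)) = -q * binExp q g := by
    rw [← binExp_mul_left]; congr 1; funext U; ring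
  rw [e1, e2]
  ring

theorem binExp_mul_ind {g : Finset (Fin n) → ℝ} {x : Fin n} (h : Ignores g x) :
    binExp q (fun U => g U * ind x U) = q * binExp q g := by
  have := binExp_mul_ind_sub (q := q) h
  simp only [mul_sub, binExp_sub] at this
  have e2 : binExp q (fun U => g U * q) = q * binExp q g := by
    rw [← binExp_mul_left]; congr 1; funext U; ring
  linarith

theorem binExp_mul_exp_ind_sub {g : Finset (Fin n) → ℝ} {x y : Fin n} (hx : Ignores g x)
    (hy : Ignores g y) (hxy : x ≠ y) (s : ℝ) :
    binExp q (fun U => g U * (Real.exp (s * (ind x U - ind y U)) - 1)) =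
      2 * (q * (1 - q)) * (Real.cosh s - 1) * binExp q g := by
  have e : ∀ c : ℝ, binExp q (fun U => g U * c) = c * binExp q g := by
    intro c; rw [← binExp_mul_left]; congr 1; funext U; ring
  rw [binExp_resample x]
  rw [binExp_resample y (fun U => _), binExp_resample y (fun U => g (U.erase x) * _)]
  simp only [hx _, hx.erase, hy _, hy.erase, ind, Finset.mem_insert_self, Finset.notMem_erase,
    if_true, if_false, Finset.mem_insert, Finset.mem_erase, hxy.symm, ne_eq,
    not_false_eq_true, or_true, true_and, false_or, and_false, e, Real.cosh_eq]
  simp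
  ring

theorem binExp_ind_sub_sq (x : Fin n) :
    binExp q (fun U => (ind x U - q) * (ind x U - q)) = q * (1 - q) := by
  rw [binExp_resample x]
  simp only [ind, Finset.mem_insert_self, Finset.notMem_erase, if_true, if_false, binExp_const]
  ring

theorem sum_ind (U : Finset (Fin n)) : ∑ x, ind x U = U.card := by
  simp [ind]

theorem binExp_variance :
    binExp q (fun U : Finset (Fin n) => ((U.card : ℝ) - n * q) ^ 2) = n * (q * (1 - q)) := by
  have e : ∀ U : Finset (Fin n), ((U.card : ℝ) - n * q) ^ 2 =
      ∑ x, ∑ y, (ind y U - q) * (ind x U - q) := by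
    intro U
    simp_rw [← Finset.sum_mul, ← Finset.mul_sum, Finset.sum_sub_distrib, sum_ind]
    simp
    ring
  simp_rw [e]
  rw [binExp_sum]
  simp_rw [binExp_sum]
  have e2 : ∀ x y : Fin n, binExp q (fun U => (ind y U - q) * (ind x U - q)) =
      if x = y then q * (1 - q) else 0 := by
    intro x y
    split_ifs with h
    · subst h; exact binExp_ind_sub_sq x
    · refine binExp_mul_ind_sub (g := fun U => ind y U - q) ?_
      intro U
      simp [ind, Ne.symm h]
  simp [e2]

/-- Chebyshev's inequality for the cardinality of a binomial random set. -/
theorem binExp_chebyshev (h0 : 0 ≤ q) (h1 : q ≤ 1) {p : Finset (Fin n) → Prop} [DecidablePred p]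
    {a : ℝ} (ha : 0 < a) (hp : ∀ U, p U → a ≤ |(U.card : ℝ) - n * q|) :
    binExp q (fun U => if p U then 1 else 0) ≤ n * (q * (1 - q)) / a ^ 2 := by
  rw [le_div_iff₀ (by positivity), ← binExp_variance, mul_comm, ← binExp_mul_left]
  refine binExp_mono h0 h1 fun U => ?_
  split_ifs with h
  · rw [mul_one, ← sq_abs ((U.card : ℝ) - n * q)]
    exact pow_le_pow_left₀ ha.le (hp U h) 2
  · rw [mul_zero]; positivity

/-- Russo's formula: the derivative of the expectation in the inclusion probability, as a sum over
the keys of the covariances with the inclusion of the key. -/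
theorem hasDerivAt_binExp (g : Finset (Fin n) → ℝ) (q : ℝ) :
    ∃ d, HasDerivAt (fun q => binExp q g) d q ∧
      q * (1 - q) * d = ∑ x, binExp q (fun U => g U * (ind x U - q)) := by
  refine ⟨∑ U, ((U.card : ℝ) * q ^ (U.card - 1) * (1 - q) ^ (n - U.card) +
    q ^ U.card * (((n - U.card : ℕ) : ℝ) * (1 - q) ^ (n - U.card - 1) * (-1))) * g U, ?_, ?_⟩
  · unfold binExp
    refine HasDerivAt.fun_sum fun U _ => ?_
    refine HasDerivAt.mul_const ?_ _
    refine HasDerivAt.mul (hasDerivAt_pow _ _) ?_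
    exact ((hasDerivAt_id q).const_sub 1).pow _
  · rw [← binExp_sum, Finset.mul_sum]
    unfold binExp
    refine Finset.sum_congr rfl fun U _ => ?_
    beta_reduce
    rw [← Finset.mul_sum, Finset.sum_sub_distrib, sum_ind]
    have hc : U.card ≤ n := by simpa using U.card_le_univ
    have h1 : q * ((U.card : ℝ) * q ^ (U.card - 1)) = U.card * q ^ U.card := by
      rcases Nat.eq_zero_or_pos U.card with h | h
      · simp [h]
      · obtain ⟨m, hm⟩ := Nat.exists_eq_succ_of_ne_zero h.ne'
        rw [hm]; simp [pow_succ]; ring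
    have h2 : (1 - q) * (((n - U.card : ℕ) : ℝ) * (1 - q) ^ (n - U.card - 1)) =
        (n - U.card : ℕ) * (1 - q) ^ (n - U.card) := by
      rcases Nat.eq_zero_or_pos (n - U.card) with h | h
      · simp [h]
      · obtain ⟨m, hm⟩ := Nat.exists_eq_succ_of_ne_zero h.ne'
        rw [hm]; simp [pow_succ]; ring
    calc _ = ((q * ((U.card : ℝ) * q ^ (U.card - 1))) * (1 - q) ^ (n - U.card) * (1 - q)
          - q * q ^ U.card * ((1 - q) * (((n - U.card : ℕ) : ℝ) * (1 - q) ^ (n - U.card - 1))))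
          * g U := by ring
      _ = _ := by
        rw [h1, h2, Nat.cast_sub hc]
        simp
        ring

end BinomialExpectation

/-! ### Averages over the random sampling rate -/

section QueryDistribution

/-- The sampling rates that occur lie in `[1 / 20, 1 / 4]`. -/
theorem rateExp_nonneg_range {g : ℝ → ℝ} (h : ∀ q, 1 / 20 ≤ q → q ≤ 1 / 4 → 0 ≤ g q) :
    0 ≤ rateExp g := by
  unfold rateExp omega
  refine mul_nonneg (by norm_num) (intervalIntegral.integral_nonneg (by norm_num) ?_)
  intro D hD
  refine mul_nonneg (by norm_num) (intervalIntegral.integral_nonneg (by linarith) ?_)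
  intro x hx
  have h4 : (4 : ℝ) ≤ x := by linarith [hx.1, hD.1]
  have h20 : x ≤ (20 : ℝ) := by linarith [hx.2, hD.2]
  exact h _ (one_div_le_one_div_of_le (by linarith) h20)
    (one_div_le_one_div_of_le (by norm_num) h4)

theorem rateExp_const_mul (c : ℝ) (f : ℝ → ℝ) : rateExp (fun q => c * f q) = c * rateExp f := by
  unfold rateExp
  simp only [intervalIntegral.integral_const_mul]
  ring

theorem rateExp_add {f g : ℝ → ℝ} (hf : Continuous f) (hg : Continuous g) :
    rateExp (fun q => f q + g q) = rateExp f + rateExp g := by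
  have := rateExp_sum Finset.univ (fun b : Bool => if b then f else g) (by
    intro b; cases b <;> simpa)
  simpa using this

theorem rateExp_mono {f g : ℝ → ℝ} (hf : Continuous f) (hg : Continuous g)
    (h : ∀ q, 1 / 20 ≤ q → q ≤ 1 / 4 → f q ≤ g q) : rateExp f ≤ rateExp g := by
  have h1 : rateExp g = rateExp f + rateExp fun q => g q - f q := by
    rw [← rateExp_add hf (g := fun q => g q - f q) (hg.sub hf)]
    simp
  have h2 : 0 ≤ rateExp fun q => g q - f q :=
    rateExp_nonneg_range fun q a b => sub_nonneg.2 (h q a b)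
  linarith

theorem rateExp_const (c : ℝ) : rateExp (fun _ => c) = c := by
  have := rateExp_const_mul c fun _ => 1
  rw [rateExp_one] at this
  simpa using this

theorem sum_sampleWeight_mul {n : ℕ} (g : Finset (Fin n) → ℝ) :
    ∑ U, sampleWeight U * g U = rateExp fun q => binExp q g := by
  unfold binExp
  rw [rateExp_sum _ _ fun U => by fun_prop]
  refine Finset.sum_congr rfl fun U _ => ?_
  unfold sampleWeight
  rw [mul_comm, ← rateExp_const_mul]
  congr 1
  funext q
  ring

/-! ### The query distribution given the cardinality of the query -/

variable {n : ℕ}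

/-- The law of `M ∪ U`: the keys of `M` are certain, the others are included independently. -/
theorem binExp_eq_union (M Q : Finset (Fin n)) (q : ℝ) :
    binExp q (fun U => if Q = M ∪ U then 1 else 0) =
      if M ⊆ Q then q ^ (Q.card - M.card) * (1 - q) ^ (n - Q.card) else 0 := by
  split_ifs with hMQ
  · unfold binExp
    simp only [mul_ite, mul_one, mul_zero]
    rw [← Finset.sum_filter]
    have hQ : Q.card ≤ n := by simpa using Q.card_le_univ
    have hMc : M.card ≤ Q.card := Finset.card_le_card hMQ
    have : ∑ U with Q = M ∪ U, q ^ U.card * (1 - q) ^ (n - U.card) =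
        ∑ V ∈ M.powerset, q ^ (Q.card - M.card) * (1 - q) ^ (n - Q.card) *
          (q ^ V.card * (1 - q) ^ (M.card - V.card)) := by
      symm
      refine Finset.sum_bij' (fun V _ => (Q \ M) ∪ V) (fun U _ => U ∩ M) ?_ ?_ ?_ ?_ ?_
      · intro V hV
        rw [Finset.mem_powerset] at hV
        simp only [Finset.mem_filter, Finset.mem_univ, true_and]
        ext z
        have := @hMQ z
        have := @hV z
        simp only [Finset.mem_union, Finset.mem_sdiff]
        tauto
      · intro U _
        simp
      · intro V hV
        rw [Finset.mem_powerset] at hV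
        ext z
        have := @hV z
        simp only [Finset.mem_union, Finset.mem_sdiff, Finset.mem_inter]
        tauto
      · intro U hU
        simp only [Finset.mem_filter, Finset.mem_univ, true_and] at hU
        ext z
        have : z ∈ Q ↔ z ∈ M ∪ U := by rw [← hU]
        simp only [Finset.mem_union, Finset.mem_sdiff, Finset.mem_inter] at this ⊢
        tauto
      · intro V hV
        rw [Finset.mem_powerset] at hV
        have hVc := Finset.card_le_card hV
        have hd : Disjoint (Q \ M) V :=
          Finset.disjoint_of_subset_right hV Finset.sdiff_disjoint
        rw [Finset.card_union_of_disjoint hd, Finset.card_sdiff_of_subset hMQ, pow_add]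
        have : n - (Q.card - M.card + V.card) = (n - Q.card) + (M.card - V.card) := by omega
        rw [this, pow_add]
        ring
    rw [this, ← Finset.mul_sum, Finset.sum_pow_mul_eq_add_pow]
    simp
  · have : ∀ U, ¬ Q = M ∪ U := fun U h => hMQ (h ▸ Finset.subset_union_left)
    simp only [this, if_false, binExp_const]

theorem binExp_union (M : Finset (Fin n)) (q : ℝ) (g : Finset (Fin n) → ℝ) :
    binExp q (fun U => g (M ∪ U)) =
      ∑ Q with M ⊆ Q, q ^ (Q.card - M.card) * (1 - q) ^ (n - Q.card) * g Q := by
  have h : (fun U => g (M ∪ U)) = fun U => ∑ Q, g Q * (if Q = M ∪ U then 1 else 0) := by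
    funext U; simp
  rw [h, binExp_sum, Finset.sum_filter]
  refine Finset.sum_congr rfl fun Q _ => ?_
  rw [binExp_mul_left, binExp_eq_union]
  split_ifs <;> ring

theorem queryDist_toReal (M Q : Finset (Fin n)) :
    (queryDist M Q).toReal =
      if M ⊆ Q then rateExp fun q => q ^ (Q.card - M.card) * (1 - q) ^ (n - Q.card) else 0 := by
  have h1 : (queryDist M Q).toReal = ∑ U, sampleWeight U * (if Q = M ∪ U then 1 else 0) := by
    unfold queryDist
    rw [PMF.map_apply, tsum_fintype, ENNReal.toReal_sum]
    · refine Finset.sum_congr rfl fun U _ => ?_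
      split_ifs
      · rw [mul_one]
        exact ENNReal.toReal_ofReal (sampleWeight_nonneg U)
      · simp
    · intro U _
      split_ifs
      · exact ENNReal.ofReal_ne_top
      · simp
  rw [h1, sum_sampleWeight_mul]
  simp_rw [binExp_eq_union]
  split_ifs
  · rfl
  · exact rateExp_const 0

theorem rateExp_weight_pos (a b : ℕ) : 0 < rateExp fun q => q ^ a * (1 - q) ^ b := by
  have h : (1 / 20 : ℝ) ^ a * (3 / 4) ^ b ≤ rateExp fun q => q ^ a * (1 - q) ^ b := by
    rw [← rateExp_const ((1 / 20 : ℝ) ^ a * (3 / 4) ^ b)]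
    refine rateExp_mono (by fun_prop) (by fun_prop) fun q h1 h2 => ?_
    gcongr
    linarith
  exact lt_of_lt_of_le (by positivity) h

/-- Given its cardinality `c`, the query `M ∪ U` is uniform on the supersets of `M` of cardinality
`c`, whatever the sampling rate was. Hence an inequality that holds given each cardinality holds at
each rate. -/
theorem binExp_union_nonneg {M : Finset (Fin n)} {q : ℝ} (h0 : 0 ≤ q) (h1 : q ≤ 1)
    {g : Finset (Fin n) → ℝ}
    (hg : ∀ c : ℕ, 0 < cardProb (queryDist M) c →
      0 ≤ ∑ Q : Finset (Fin n) with Q.card = c, (queryDist M Q).toReal * g Q) :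
    0 ≤ binExp q (fun U => g (M ∪ U)) := by
  rw [binExp_union, Finset.sum_filter,
    ← Finset.sum_fiberwise_of_maps_to (s := Finset.univ) (t := Finset.range (n + 1))
      (g := Finset.card) (fun Q _ => by
        rw [Finset.mem_range]; exact Nat.lt_succ_of_le (by simpa using Q.card_le_univ))]
  refine Finset.sum_nonneg fun c _ => ?_
  set d := rateExp fun q => q ^ (c - M.card) * (1 - q) ^ (n - c) with hd
  have hdpos : 0 < d := rateExp_weight_pos _ _
  set w := q ^ (c - M.card) * (1 - q) ^ (n - c) with hw
  have hw0 : 0 ≤ w := binWeight_nonneg h0 h1 _ _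
  have e1 : ∑ Q : Finset (Fin n) with Q.card = c,
      (if M ⊆ Q then q ^ (Q.card - M.card) * (1 - q) ^ (n - Q.card) * g Q else 0) =
      w * ∑ Q : Finset (Fin n) with Q.card = c, if M ⊆ Q then g Q else 0 := by
    rw [Finset.mul_sum]
    refine Finset.sum_congr rfl fun Q hQ => ?_
    rw [(Finset.mem_filter.1 hQ).2]
    split_ifs <;> simp [hw]
  have e2 : ∑ Q : Finset (Fin n) with Q.card = c, (queryDist M Q).toReal * g Q =
      d * ∑ Q : Finset (Fin n) with Q.card = c, if M ⊆ Q then g Q else 0 := by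
    rw [Finset.mul_sum]
    refine Finset.sum_congr rfl fun Q hQ => ?_
    rw [queryDist_toReal, (Finset.mem_filter.1 hQ).2]
    split_ifs <;> simp [hd]
  rw [e1]
  refine mul_nonneg hw0 ?_
  by_cases hc : 0 < cardProb (queryDist M) c
  · have := hg c hc
    rw [e2] at this
    exact nonneg_of_mul_nonneg_right this hdpos
  · have hne : ∀ Q : Finset (Fin n), Q.card = c → ¬ M ⊆ Q := by
      intro Q hQ hM
      refine hc ?_
      unfold cardProb
      refine Finset.sum_pos' (fun Q _ => ENNReal.toReal_nonneg) ⟨Q, by simp [hQ], ?_⟩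
      rw [queryDist_toReal, if_pos hM]
      exact rateExp_weight_pos _ _
    refine Finset.sum_nonneg fun Q hQ => ?_
    rw [if_neg (hne Q (Finset.mem_filter.1 hQ).2)]

/-- A correct map answers `1` with probability close to `1` at rates for which the query has more
than `2 A` keys with high probability. -/
theorem IsCorrect.le_binExp {Sk : Type} {S : Finset (Fin n) → Sk} {δ : ℝ} {M : Finset (Fin n)}
    {π : Sk → unitInterval} (h : IsCorrect S (threshold n) δ (queryDist M) π) (hδ : 0 ≤ δ)
    {q : ℝ} (h0 : 0 ≤ q) (h1 : q ≤ 1) :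
    1 - δ - binExp q (fun U : Finset (Fin n) => if (U.card : ℝ) ≤ n / 8 then 1 else 0) ≤
      binExp q fun U => (π (S (M ∪ U)) : ℝ) := by
  have key := binExp_union_nonneg (M := M) h0 h1
    (g := fun Q => (π (S Q) : ℝ) - ((1 - δ) - if (Q.card : ℝ) ≤ n / 8 then 1 else 0)) ?_
  · rw [binExp_sub, binExp_sub, binExp_const] at key
    have hm : binExp q (fun U : Finset (Fin n) => if ((M ∪ U).card : ℝ) ≤ n / 8 then (1 : ℝ) else 0) ≤
        binExp q (fun U : Finset (Fin n) => if (U.card : ℝ) ≤ n / 8 then 1 else 0) := by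
      refine binExp_mono h0 h1 fun U => ?_
      have hc : (U.card : ℝ) ≤ (M ∪ U).card := by
        exact_mod_cast Finset.card_le_card Finset.subset_union_right
      split_ifs with a b <;> linarith
    linarith
  · intro c hc
    by_cases hcA : (c : ℝ) ≤ n / 8
    · refine Finset.sum_nonneg fun Q hQ => mul_nonneg ENNReal.toReal_nonneg ?_
      rw [(Finset.mem_filter.1 hQ).2, if_pos hcA]
      linarith [(π (S Q)).2.1]
    · have := (h c hc).2 (by unfold threshold; linarith)
      rw [condExp, le_div_iff₀ hc] at this
      have e : ∑ Q : Finset (Fin n) with Q.card = c, (queryDist M Q).toReal *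
          ((π (S Q) : ℝ) - ((1 - δ) - if (Q.card : ℝ) ≤ n / 8 then 1 else 0)) =
          ∑ Q : Finset (Fin n) with Q.card = c, (queryDist M Q).toReal * (π (S Q) : ℝ) -
            (1 - δ) * cardProb (queryDist M) c := by
        unfold cardProb
        rw [Finset.mul_sum, ← Finset.sum_sub_distrib]
        refine Finset.sum_congr rfl fun Q hQ => ?_
        rw [(Finset.mem_filter.1 hQ).2, if_neg hcA]
        ring
      rw [e]
      linarith

/-- A correct map answers `1` with probability close to `0` at rates for which the query has fewer
than `A` keys with high probability. -/
theorem IsCorrect.binExp_le {Sk : Type} {S : Finset (Fin n) → Sk} {δ : ℝ} {M : Finset (Fin n)}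
    {π : Sk → unitInterval} (h : IsCorrect S (threshold n) δ (queryDist M) π) (hδ : 0 ≤ δ)
    {q : ℝ} (h0 : 0 ≤ q) (h1 : q ≤ 1) :
    binExp q (fun U => (π (S (M ∪ U)) : ℝ)) ≤
      δ + binExp q (fun U : Finset (Fin n) => if (n : ℝ) / 16 ≤ M.card + U.card then 1 else 0) := by
  have key := binExp_union_nonneg (M := M) h0 h1
    (g := fun Q => (δ + if (n : ℝ) / 16 ≤ Q.card then 1 else 0) - (π (S Q) : ℝ)) ?_
  · rw [binExp_sub, binExp_add, binExp_const] at key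
    have hm : binExp q (fun U : Finset (Fin n) => if (n : ℝ) / 16 ≤ (M ∪ U).card then (1 : ℝ) else 0) ≤
        binExp q (fun U : Finset (Fin n) => if (n : ℝ) / 16 ≤ M.card + U.card then 1 else 0) := by
      refine binExp_mono h0 h1 fun U => ?_
      have hc : ((M ∪ U).card : ℝ) ≤ M.card + U.card := by
        exact_mod_cast Finset.card_union_le M U
      split_ifs with a b <;> linarith
    linarith
  · intro c hc
    by_cases hcA : (n : ℝ) / 16 ≤ c
    · refine Finset.sum_nonneg fun Q hQ => mul_nonneg ENNReal.toReal_nonneg ?_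
      rw [(Finset.mem_filter.1 hQ).2, if_pos hcA]
      linarith [(π (S Q)).2.2]
    · have := (h c hc).1 (by unfold threshold; linarith)
      rw [condExp, div_le_iff₀ hc] at this
      have e : ∑ Q : Finset (Fin n) with Q.card = c, (queryDist M Q).toReal *
          ((δ + if (n : ℝ) / 16 ≤ Q.card then 1 else 0) - (π (S Q) : ℝ)) =
          δ * cardProb (queryDist M) c -
          ∑ Q : Finset (Fin n) with Q.card = c, (queryDist M Q).toReal * (π (S Q) : ℝ) := by
        unfold cardProb
        rw [Finset.mul_sum, ← Finset.sum_sub_distrib]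
        refine Finset.sum_congr rfl fun Q hQ => ?_
        rw [(Finset.mem_filter.1 hQ).2, if_neg hcA]
        ring
      rw [e]
      linarith

end QueryDistribution

/-! ### The variance of the difference of two scores -/

section RateIntegrals

theorem rateExp_nonneg_of_inner {g : ℝ → ℝ}
    (h : ∀ D, 0 ≤ D → D ≤ 2 → 0 ≤ ∫ x in (4 + D)..(18 + D), g (1 / x)) : 0 ≤ rateExp g := by
  unfold rateExp omega
  refine mul_nonneg (by norm_num) (intervalIntegral.integral_nonneg (by norm_num) ?_)
  intro D hD
  refine mul_nonneg (by norm_num) ?_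
  have := h D hD.1 (by linarith [hD.2])
  have e1 : (8 / 2 + D : ℝ) = 4 + D := by ring
  have e2 : (4 + D + 7 / 4 * 8 : ℝ) = 18 + D := by ring
  rwa [e1, e2]

/-- Twice this variance is the probability that a sampled set separates two given keys. The bound has
to be below `3 / 32`, where the exponent of `one_add_mul_cosh_sub_one_le` would become `s ^ 2 / 8`:
that exponent gives failure probabilities of order `1 / (n r)`, too large for a union bound. -/
theorem rateExp_mul_one_sub_le : rateExp (fun q => q * (1 - q)) ≤ 9 / 100 := by
  -- A cubic majorant of `(x - 1) / x ^ 2` on `[4, 20]` that touches it at `4`, `10` and `20`.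
  let P : ℝ → ℝ := fun x => 133 / 400 - 187 / 4000 * x + 23 / 8000 * x ^ 2 - 1 / 16000 * x ^ 3
  have hc : Continuous fun q : ℝ => P (1 / max q (1 / 20)) := by
    have : Continuous P := by fun_prop
    refine this.comp (continuous_const.div (by fun_prop) fun q => ?_)
    have : (1 / 20 : ℝ) ≤ max q (1 / 20) := le_max_right _ _
    linarith
  have h1 : rateExp (fun q => q * (1 - q)) ≤ rateExp fun q => P (1 / max q (1 / 20)) := by
    refine rateExp_mono (by fun_prop) hc fun q a b => ?_
    rw [max_eq_left a]
    have hq : 0 < q := by linarith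
    obtain ⟨x, hx, rfl⟩ : ∃ x : ℝ, 0 < x ∧ q = 1 / x := ⟨1 / q, by positivity, by field_simp⟩
    have hx4 : 4 ≤ x := by
      rw [div_le_div_iff₀ hx (by norm_num)] at b; linarith
    have hx20 : x ≤ 20 := by
      rw [div_le_div_iff₀ (by norm_num) hx] at a; linarith
    rw [one_div_one_div]
    have e : P x - 1 / x * (1 - 1 / x) =
        (x - 4) * (20 - x) * (x - 10) ^ 2 * (x - 2) / (16000 * x ^ 2) := by
      simp only [P]
      field_simp
      ring
    have : 0 ≤ P x - 1 / x * (1 - 1 / x) := by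
      rw [e]
      refine div_nonneg (mul_nonneg (mul_nonneg (mul_nonneg ?_ ?_) (sq_nonneg _)) ?_)
        (by positivity) <;> linarith
    linarith
  refine h1.trans ?_
  have h2 : rateExp (fun q => P (1 / max q (1 / 20))) = 4 / omega *
      ∫ D in (0 : ℝ)..(omega / 4), 4 / (7 * omega) *
        ∫ x in (omega / 2 + D)..(omega / 2 + D + 7 / 4 * omega), P x := by
    unfold rateExp omega
    congr 1
    apply intervalIntegral.integral_congr
    intro D hD
    rw [Set.uIcc_of_le (by norm_num)] at hD
    simp only
    congr 1
    apply intervalIntegral.integral_congr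
    intro x hx
    rw [Set.uIcc_of_le (by linarith)] at hx
    have h4 : (4 : ℝ) ≤ x := by linarith [hx.1, hD.1]
    have h20 : x ≤ (20 : ℝ) := by linarith [hx.2, hD.2]
    simp only
    rw [max_eq_left (one_div_le_one_div_of_le (by linarith) h20), one_div_one_div]
  rw [h2]
  have hP : ∀ a b : ℝ, ∫ x in a..b, P x =
      (133 / 400 * b - 187 / 8000 * b ^ 2 + 23 / 24000 * b ^ 3 - 1 / 64000 * b ^ 4) -
      (133 / 400 * a - 187 / 8000 * a ^ 2 + 23 / 24000 * a ^ 3 - 1 / 64000 * a ^ 4) := by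
    intro a b
    refine intervalIntegral.integral_eq_sub_of_hasDerivAt
      (f := fun x => 133 / 400 * x - 187 / 8000 * x ^ 2 + 23 / 24000 * x ^ 3 - 1 / 64000 * x ^ 4)
      (fun x _ => ?_) ((by fun_prop : Continuous P).intervalIntegrable _ _)
    have h := ((((hasDerivAt_id x).const_mul (133 / 400 : ℝ)).sub
      ((hasDerivAt_pow 2 x).const_mul (187 / 8000 : ℝ))).add
      ((hasDerivAt_pow 3 x).const_mul (23 / 24000 : ℝ))).sub
      ((hasDerivAt_pow 4 x).const_mul (1 / 64000 : ℝ))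
    refine h.congr_deriv ?_
    simp only [P]
    push_cast
    ring
  simp_rw [hP]
  unfold omega
  let R : ℝ → ℝ := fun D => 4 / (7 * 8) *
    ((133 / 400 * (18 + D) ^ 2 / 2 - 187 / 8000 * (18 + D) ^ 3 / 3 + 23 / 24000 * (18 + D) ^ 4 / 4
      - 1 / 64000 * (18 + D) ^ 5 / 5) -
    (133 / 400 * (4 + D) ^ 2 / 2 - 187 / 8000 * (4 + D) ^ 3 / 3 + 23 / 24000 * (4 + D) ^ 4 / 4
      - 1 / 64000 * (4 + D) ^ 5 / 5))
  rw [intervalIntegral.integral_eq_sub_of_hasDerivAt (f := R) (fun D _ => ?_)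
    (Continuous.intervalIntegrable (by fun_prop) _ _)]
  · simp only [R]; norm_num
  · have hp : ∀ (c : ℝ) (m : ℕ), HasDerivAt (fun D : ℝ => (c + D) ^ m) (m * (c + D) ^ (m - 1)) D := by
      intro c m
      simpa using ((hasDerivAt_id' D).const_add c).fun_pow m
    have h := (((((((hp 18 2).const_mul (133 / 400 : ℝ)).div_const 2).sub
      (((hp 18 3).const_mul (187 / 8000 : ℝ)).div_const 3)).add
      (((hp 18 4).const_mul (23 / 24000 : ℝ)).div_const 4)).sub
      (((hp 18 5).const_mul (1 / 64000 : ℝ)).div_const 5)).sub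
      ((((((hp 4 2).const_mul (133 / 400 : ℝ)).div_const 2).sub
      (((hp 4 3).const_mul (187 / 8000 : ℝ)).div_const 3)).add
      (((hp 4 4).const_mul (23 / 24000 : ℝ)).div_const 4)).sub
      (((hp 4 5).const_mul (1 / 64000 : ℝ)).div_const 5))).const_mul (4 / (7 * 8) : ℝ)
    refine h.congr_deriv ?_
    push_cast
    ring

/-- A comparison of power series, the analogue of `Real.cosh_le_exp_half_sq` for a random variable
on `{-1, 0, 1}` that is nonzero with probability `0.18`. -/
theorem one_add_mul_cosh_sub_one_le (s : ℝ) :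
    1 + 18 / 100 * (Real.cosh s - 1) ≤ Real.exp (25 * s ^ 2 / 204) := by
  have hc := Real.hasSum_cosh s
  have he : HasSum (fun i : ℕ => (25 * s ^ 2 / 204) ^ i / i.factorial)
      (Real.exp (25 * s ^ 2 / 204)) := by
    rw [Real.exp_eq_exp_ℝ]
    exact NormedSpace.expSeries_div_hasSum_exp (25 * s ^ 2 / 204)
  have h0 : HasSum (fun i : ℕ => if i = 0 then (82 / 100 : ℝ) else 0) (82 / 100) := hasSum_ite_eq 0 _
  have hl := h0.add (hc.mul_left (18 / 100 : ℝ))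
  have : 1 + 18 / 100 * (Real.cosh s - 1) = 82 / 100 + 18 / 100 * Real.cosh s := by ring
  rw [this]
  refine hasSum_le (fun i => ?_) hl he
  rcases i with _ | i
  · norm_num
  · have key : ∀ i : ℕ, 18 / 100 * (204 / 25 : ℝ) ^ (i + 1) * ((i + 1).factorial : ℝ) ≤
        ((2 * (i + 1)).factorial : ℝ) := by
      intro i
      rcases i with _ | i
      · norm_num [Nat.factorial]
      induction i with
      | zero => norm_num [Nat.factorial]
      | succ i ih =>
        have e1 : ((2 * (i + 1 + 1 + 1)).factorial : ℝ) =
            (2 * i + 6) * (2 * i + 5) * ((2 * (i + 1 + 1)).factorial : ℝ) := by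
          have : 2 * (i + 1 + 1 + 1) = 2 * (i + 1 + 1) + 1 + 1 := by ring
          rw [this, Nat.factorial_succ, Nat.factorial_succ]
          push_cast
          ring
        have e2 : ((i + 1 + 1 + 1).factorial : ℝ) = (i + 3) * ((i + 1 + 1).factorial : ℝ) := by
          rw [Nat.factorial_succ]
          push_cast
          ring
        rw [e1, e2, pow_succ]
        calc 18 / 100 * ((204 / 25 : ℝ) ^ (i + 1 + 1) * (204 / 25)) *
              ((i + 3) * ((i + 1 + 1).factorial : ℝ))
            = (204 / 25 * (i + 3)) * (18 / 100 * (204 / 25 : ℝ) ^ (i + 1 + 1) *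
              ((i + 1 + 1).factorial : ℝ)) := by ring
          _ ≤ ((2 * i + 6) * (2 * i + 5)) * ((2 * (i + 1 + 1)).factorial : ℝ) := by
            refine mul_le_mul ?_ ih (by positivity) (by positivity)
            have : (0 : ℝ) ≤ i := Nat.cast_nonneg i
            nlinarith
    have hs : (0 : ℝ) ≤ (s ^ 2) ^ (i + 1) := by positivity
    have hk := key i
    rw [if_neg (Nat.succ_ne_zero i), zero_add, pow_mul]
    have e : (25 * s ^ 2 / 204) ^ (i + 1) = (s ^ 2) ^ (i + 1) / (204 / 25 : ℝ) ^ (i + 1) := by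
      rw [← div_pow]; congr 1; ring
    rw [e, div_div, ← mul_div_assoc, div_le_div_iff₀ (by positivity) (by positivity)]
    calc 18 / 100 * (s ^ 2) ^ (i + 1) * ((204 / 25 : ℝ) ^ (i + 1) * ((i + 1).factorial : ℝ))
        = (s ^ 2) ^ (i + 1) * (18 / 100 * (204 / 25 : ℝ) ^ (i + 1) * ((i + 1).factorial : ℝ)) := by
          ring
      _ ≤ _ := mul_le_mul_of_nonneg_left hk hs

/-! ### The total score advantage -/

/-- Russo's formula, integrated by parts in `x = 1 / q`: if the expectation of `g` rises from almost
`0` to almost `1` as the rate rises through `[1 / 18, 2 / 15]`, then the total correlation of `g`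
with the inclusion of keys is at least a constant. -/
theorem le_rateExp_sum_correlation {n : ℕ} {g : Finset (Fin n) → ℝ} (hg : ∀ U, 0 ≤ g U)
    (hhigh : ∀ q, 2 / 15 ≤ q → q ≤ 1 / 4 → 99 / 100 ≤ binExp q g)
    (hlow : ∀ q, 1 / 20 ≤ q → q ≤ 1 / 18 → binExp q g ≤ 1 / 100) :
    44 / 100 ≤ rateExp fun q => ∑ x, binExp q fun U => g U * (ind x U - q) := by
  set h : ℝ → ℝ := fun q => ∑ x, binExp q fun U => g U * (ind x U - q) with hh
  have hcont : Continuous h := by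
    refine continuous_finsetSum _ fun x _ => ?_
    unfold binExp
    fun_prop
  have key : 0 ≤ rateExp fun q => h q + (-(44 / 100)) := by
    refine rateExp_nonneg_of_inner fun D hD0 hD2 => ?_
    set a := 4 + D with ha
    set b := 18 + D with hb
    have hab : a ≤ b := by linarith
    set G : ℝ → ℝ := fun x => binExp (1 / x) g with hG
    have hinv : ContinuousOn (fun x : ℝ => 1 / x) (Set.uIcc a b) := by
      refine ContinuousOn.div continuousOn_const continuousOn_id fun x hx => ?_
      rw [Set.uIcc_of_le hab] at hx
      have : 0 < x := by linarith [hx.1]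
      exact this.ne'
    have hGc : ContinuousOn G (Set.uIcc a b) := (continuous_binExp g).comp_continuousOn hinv
    have hhc : ContinuousOn (fun x => h (1 / x)) (Set.uIcc a b) := hcont.comp_continuousOn hinv
    have hder : ∀ x ∈ Set.uIcc a b,
        HasDerivAt (fun x => -((x - 1) * G x)) (h (1 / x) - G x) x := by
      intro x hx
      rw [Set.uIcc_of_le hab] at hx
      have hx0 : 0 < x := by linarith [hx.1]
      obtain ⟨d, hd, hde⟩ := hasDerivAt_binExp g (1 / x)
      have hi : HasDerivAt (fun x : ℝ => 1 / x) (-(x ^ 2)⁻¹) x := by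
        simpa using hasDerivAt_inv hx0.ne'
      have h1 : HasDerivAt G (d * (-(x ^ 2)⁻¹)) x := hd.comp x hi
      have h2 := (((hasDerivAt_id x).sub_const 1).mul h1).neg
      refine h2.congr_deriv ?_
      rw [hh]
      beta_reduce
      rw [← hde]
      simp only [id]
      field_simp
      ring
    have hint := intervalIntegral.integral_eq_sub_of_hasDerivAt hder
      (hhc.intervalIntegrable.sub hGc.intervalIntegrable)
    rw [intervalIntegral.integral_sub hhc.intervalIntegrable hGc.intervalIntegrable] at hint
    have hsub1 : Set.uIcc a (15 / 2) ⊆ Set.uIcc a b := by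
      rw [Set.uIcc_of_le hab, Set.uIcc_of_le (by linarith)]
      exact Set.Icc_subset_Icc le_rfl (by linarith)
    have hsub2 : Set.uIcc (15 / 2) b ⊆ Set.uIcc a b := by
      rw [Set.uIcc_of_le hab, Set.uIcc_of_le (by linarith)]
      exact Set.Icc_subset_Icc (by linarith) le_rfl
    have hsplit := intervalIntegral.integral_add_adjacent_intervals (μ := volume)
      (hGc.mono hsub1).intervalIntegrable (hGc.mono hsub2).intervalIntegrable
    have hI1 : (15 / 2 - a) * (99 / 100) ≤ ∫ x in a..(15 / 2), G x := by
      have := intervalIntegral.integral_mono_on (μ := volume) (a := a) (b := 15 / 2)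
        (f := fun _ => (99 / 100 : ℝ)) (g := G) (by linarith)
        (intervalIntegrable_const (μ := volume)) (hGc.mono hsub1).intervalIntegrable (fun x hx => by
          refine hhigh _ ?_ (one_div_le_one_div_of_le (by norm_num) (by linarith [hx.1]))
          have := one_div_le_one_div_of_le (by linarith [hx.1]) hx.2
          norm_num at this ⊢
          linarith)
      rwa [intervalIntegral.integral_const, smul_eq_mul] at this
    have hI2 : 0 ≤ ∫ x in (15 / 2)..b, G x := by
      refine intervalIntegral.integral_nonneg (by linarith) fun x hx => ?_
      have hx1 : (1 : ℝ) ≤ x := by linarith [hx.1]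
      exact binExp_nonneg (by positivity) (by rw [div_le_one (by linarith)]; exact hx1) hg
    have hGa : 99 / 100 ≤ G a := by
      refine hhigh _ ?_ (one_div_le_one_div_of_le (by norm_num) (by linarith))
      have := one_div_le_one_div_of_le (by linarith) (show a ≤ 15 / 2 by linarith)
      norm_num at this ⊢
      linarith
    have hGb : G b ≤ 1 / 100 :=
      hlow _ (one_div_le_one_div_of_le (by linarith) (by linarith))
        (one_div_le_one_div_of_le (by norm_num) (by linarith))
    rw [intervalIntegral.integral_add hhc.intervalIntegrable
      (intervalIntegrable_const (μ := volume)),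
      intervalIntegral.integral_const, smul_eq_mul]
    have hba : b - a = 14 := by rw [ha, hb]; ring
    have m1 : (a - 1) * (99 / 100) ≤ (a - 1) * G a :=
      mul_le_mul_of_nonneg_left hGa (by linarith)
    have m2 : (b - 1) * G b ≤ (b - 1) * (1 / 100) :=
      mul_le_mul_of_nonneg_left hGb (by linarith)
    rw [hba]
    linarith
  rw [rateExp_add hcont continuous_const, rateExp_const] at key
  linarith

end RateIntegrals

/-! ### The median -/

section Transcripts

variable {n : ℕ}

theorem pairwise_sort (s : Multiset ℕ) : (s.sort (· ≤ ·)).Pairwise (· ≤ ·) :=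
  Multiset.pairwise_sort s (· ≤ ·)

theorem getD_sort_mono (s : Multiset ℕ) {i j : ℕ} (hij : i ≤ j) (hj : j < Multiset.card s) :
    (s.sort (· ≤ ·)).getD i 0 ≤ (s.sort (· ≤ ·)).getD j 0 := by
  have hl : (s.sort (· ≤ ·)).length = Multiset.card s := Multiset.length_sort (r := (· ≤ ·))
  rw [List.getD_eq_getElem _ _ (by omega), List.getD_eq_getElem _ _ (by omega)]
  rcases hij.eq_or_lt with h | h
  · subst h; rfl
  · exact List.pairwise_iff_getElem.1 (pairwise_sort s) _ _ (by omega) (by omega) h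

theorem median_nonneg (s : Multiset ℕ) : 0 ≤ median s := by
  unfold median; positivity

theorem countP_sort (s : Finset (Fin n)) (C : Fin n → ℕ) (p : ℕ → Prop) [DecidablePred p] :
    ((s.val.map C).sort (· ≤ ·)).countP (fun v : ℕ => decide (p v)) = (s.filter fun y => p (C y)).card := by
  rw [← Multiset.coe_countP, Multiset.sort_eq, Multiset.countP_map]
  rfl

theorem card_le_two_mul_card_le_median (s : Finset (Fin n)) (C : Fin n → ℕ) :
    s.card ≤ 2 * (s.filter fun y => (C y : ℝ) ≤ median (s.val.map C)).card := by
  classical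
  set l := (s.val.map C).sort (· ≤ ·) with hl
  have hlen : l.length = s.card := by
    rw [hl, Multiset.length_sort]; simp
  have hcard : Multiset.card (s.val.map C) = s.card := by simp
  rcases Nat.eq_zero_or_pos s.card with h0 | hpos
  · omega
  rw [← countP_sort s C fun v : ℕ => (v : ℝ) ≤ median (s.val.map C), ← hl]
  have h1 : (l.take ((s.card - 1) / 2 + 1)).countP
      (fun v : ℕ => decide ((v : ℝ) ≤ median (s.val.map C))) = (l.take ((s.card - 1) / 2 + 1)).length := by
    rw [List.countP_eq_length]
    intro v hv
    obtain ⟨i, hi, rfl⟩ := List.mem_iff_getElem.1 hv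
    rw [List.length_take] at hi
    rw [List.getElem_take, decide_eq_true_iff]
    have hm1 := getD_sort_mono (s.val.map C) (i := i) (j := (s.card - 1) / 2) (by omega)
      (by rw [hcard]; omega)
    have hm2 := getD_sort_mono (s.val.map C) (i := (s.card - 1) / 2) (j := s.card / 2) (by omega)
      (by rw [hcard]; omega)
    rw [← hl] at hm1 hm2
    rw [← List.getD_eq_getElem l 0]
    unfold median
    rw [hcard, ← hl]
    have a1 : ((l.getD i 0 : ℕ) : ℝ) ≤ (l.getD ((s.card - 1) / 2) 0 : ℕ) := by exact_mod_cast hm1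
    have a2 : ((l.getD ((s.card - 1) / 2) 0 : ℕ) : ℝ) ≤ (l.getD (s.card / 2) 0 : ℕ) := by
      exact_mod_cast hm2
    linarith
  have h2 := (List.take_sublist ((s.card - 1) / 2 + 1) l).countP_le
    (p := fun v : ℕ => decide ((v : ℝ) ≤ median (s.val.map C)))
  rw [h1, List.length_take] at h2
  omega

theorem card_le_two_mul_card_median_le (s : Finset (Fin n)) (C : Fin n → ℕ) :
    s.card ≤ 2 * (s.filter fun y => median (s.val.map C) ≤ (C y : ℝ)).card := by
  classical
  set l := (s.val.map C).sort (· ≤ ·) with hl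
  have hlen : l.length = s.card := by
    rw [hl, Multiset.length_sort]; simp
  have hcard : Multiset.card (s.val.map C) = s.card := by simp
  rcases Nat.eq_zero_or_pos s.card with h0 | hpos
  · omega
  rw [← countP_sort s C fun v : ℕ => median (s.val.map C) ≤ (v : ℝ), ← hl]
  have h1 : (l.drop (s.card / 2)).countP
      (fun v : ℕ => decide (median (s.val.map C) ≤ (v : ℝ))) = (l.drop (s.card / 2)).length := by
    rw [List.countP_eq_length]
    intro v hv
    obtain ⟨i, hi, rfl⟩ := List.mem_iff_getElem.1 hv
    rw [List.length_drop] at hi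
    rw [List.getElem_drop, decide_eq_true_iff]
    have hm1 := getD_sort_mono (s.val.map C) (i := s.card / 2) (j := s.card / 2 + i) (by omega)
      (by rw [hcard]; omega)
    have hm2 := getD_sort_mono (s.val.map C) (i := (s.card - 1) / 2) (j := s.card / 2) (by omega)
      (by rw [hcard]; omega)
    rw [← hl] at hm1 hm2
    rw [← List.getD_eq_getElem l 0]
    unfold median
    rw [hcard, ← hl]
    have a1 : ((l.getD (s.card / 2) 0 : ℕ) : ℝ) ≤ (l.getD (s.card / 2 + i) 0 : ℕ) := by
      exact_mod_cast hm1
    have a2 : ((l.getD ((s.card - 1) / 2) 0 : ℕ) : ℝ) ≤ (l.getD (s.card / 2) 0 : ℕ) := by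
      exact_mod_cast hm2
    linarith
  have h2 := (List.drop_sublist (s.card / 2) l).countP_le
    (p := fun v : ℕ => decide (median (s.val.map C) ≤ (v : ℝ)))
  rw [h1, List.length_drop] at h2
  omega

/-! ### Scores and masks within one round -/

theorem subset_mask_scoreKey (lam : ℝ) (Z : Bool) (s : AttackState n) (x : Fin n) :
    s.mask ⊆ (scoreKey lam Z s x).mask := by
  unfold scoreKey
  dsimp only
  split_ifs
  · exact Finset.subset_insert _ _
  · exact subset_rfl

theorem subset_mask_foldl_scoreKey (lam : ℝ) (Z : Bool) (l : List (Fin n)) (s : AttackState n) :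
    s.mask ⊆ (l.foldl (scoreKey lam Z) s).mask := by
  induction l generalizing s with
  | nil => exact subset_rfl
  | cons x l ih => exact (subset_mask_scoreKey lam Z s x).trans (ih _)

theorem score_foldl_scoreKey (lam : ℝ) (Z : Bool) (l : List (Fin n)) (hl : l.Nodup)
    (s : AttackState n) (z : Fin n) :
    (l.foldl (scoreKey lam Z) s).score z = s.score z + if z ∈ l then Z.toNat else 0 := by
  induction l generalizing s with
  | nil => simp
  | cons x l ih =>
    rw [List.nodup_cons] at hl
    rw [List.foldl_cons, ih hl.2]
    unfold scoreKey
    dsimp only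
    by_cases hz : z = x
    · subst hz; simp [hl.1]
    · simp [hz]

/-- If no key outside `N₀` passes the masking test, at any scores `C` that may occur in the middle
of the round, then the mask stays in `N₀`. -/
theorem mask_foldl_scoreKey_subset {N₀ : Finset (Fin n)} {lam : ℝ} {Z : Bool} {lo hi : Fin n → ℕ}
    (h : ∀ (C : Fin n → ℕ) (M : Finset (Fin n)) (x : Fin n), M ⊆ N₀ → (∀ z, lo z ≤ C z) →
      (∀ z, C z ≤ hi z) → C x = hi x → median ((Mᶜ).val.map C) + lam ≤ (C x : ℝ) → x ∈ N₀)
    (l : List (Fin n)) (hl : l.Nodup) (s : AttackState n) (hs : s.mask ⊆ N₀)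
    (hlo : ∀ z, lo z ≤ s.score z)
    (hhi : ∀ z, s.score z + (if z ∈ l then Z.toNat else 0) = hi z) :
    (l.foldl (scoreKey lam Z) s).mask ⊆ N₀ := by
  induction l generalizing s with
  | nil => exact hs
  | cons x l ih =>
    rw [List.nodup_cons] at hl
    have hlo' : ∀ z, lo z ≤ (scoreKey lam Z s x).score z := by
      intro z
      unfold scoreKey
      dsimp only
      by_cases hz : z = x
      · subst hz; simpa using (hlo z).trans (Nat.le_add_right _ _)
      · simpa [hz] using hlo z
    have hhi' : ∀ z, (scoreKey lam Z s x).score z + (if z ∈ l then Z.toNat else 0) = hi z := by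
      intro z
      rw [← hhi z]
      unfold scoreKey
      dsimp only
      by_cases hz : z = x
      · subst hz; simp [hl.1]
      · simp [hz]
    refine ih hl.2 _ ?_ hlo' hhi'
    have hx : (scoreKey lam Z s x).score x = hi x := by
      have := hhi' x
      rwa [if_neg hl.1, add_zero] at this
    have key := h (scoreKey lam Z s x).score s.mask x hs hlo'
      (fun z => by rw [← hhi' z]; exact Nat.le_add_right _ _) hx
    unfold scoreKey at key ⊢
    dsimp only at key ⊢
    split_ifs with hc
    · exact Finset.insert_subset (key hc) hs
    · exact hs

/-- A processed key that stays unmasked failed the masking test at its final score. -/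
theorem exists_lt_of_notMem_mask_foldl_scoreKey {lam : ℝ} {Z : Bool} {hi : Fin n → ℕ} {x : Fin n}
    (l : List (Fin n)) (hl : l.Nodup) (hxl : x ∈ l) (s : AttackState n)
    (hx : x ∉ (l.foldl (scoreKey lam Z) s).mask)
    (hhi : ∀ z, s.score z + (if z ∈ l then Z.toNat else 0) = hi z) :
    ∃ (C : Fin n → ℕ) (M : Finset (Fin n)), M ⊆ (l.foldl (scoreKey lam Z) s).mask ∧
      (∀ z, C z ≤ hi z) ∧ C x = hi x ∧ (C x : ℝ) < median ((Mᶜ).val.map C) + lam := by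
  induction l generalizing s with
  | nil => simp at hxl
  | cons y l ih =>
    rw [List.nodup_cons] at hl
    have hhi' : ∀ z, (scoreKey lam Z s y).score z + (if z ∈ l then Z.toNat else 0) = hi z := by
      intro z
      rw [← hhi z]
      unfold scoreKey
      dsimp only
      by_cases hz : z = y
      · subst hz; simp [hl.1]
      · simp [hz]
    by_cases hxy : x = y
    · subst hxy
      refine ⟨(scoreKey lam Z s x).score, s.mask,
        subset_mask_foldl_scoreKey lam Z (x :: l) s, ?_, ?_, ?_⟩
      · intro z; rw [← hhi' z]; exact Nat.le_add_right _ _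
      · have := hhi' x
        rwa [if_neg hl.1, add_zero] at this
      · by_contra hc
        refine hx (subset_mask_foldl_scoreKey lam Z l (scoreKey lam Z s x) ?_)
        rw [not_lt] at hc
        unfold scoreKey at hc ⊢
        dsimp only at hc ⊢
        rw [if_pos hc]
        exact Finset.mem_insert_self _ _
    · exact ih hl.2 (by simpa [hxy] using hxl) _ hx hhi'

/-! ### Scores and masks along a transcript -/

variable {r : ℕ}

theorem score_cons (U : Finset (Fin n)) (Z : Bool) (t : Transcript n) (z : Fin n) :
    (attackState r ((U, Z) :: t)).score z =
      (attackState r t).score z + if z ∈ U then Z.toNat else 0 := by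
  change (scoreRound r (t.length + 1) U Z (attackState r t)).score z = _
  unfold scoreRound
  rw [score_foldl_scoreKey _ _ _ (Finset.sort_nodup _ _)]
  simp

theorem score_le_score_cons (a : Finset (Fin n) × Bool) (t : Transcript n) (z : Fin n) :
    (attackState r t).score z ≤ (attackState r (a :: t)).score z := by
  obtain ⟨U, Z⟩ := a
  rw [score_cons]
  exact Nat.le_add_right _ _

theorem score_cons_le (a : Finset (Fin n) × Bool) (t : Transcript n) (z : Fin n) :
    (attackState r (a :: t)).score z ≤ (attackState r t).score z + 1 := by
  obtain ⟨U, Z⟩ := a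
  rw [score_cons]
  have := Z.toNat_le
  split_ifs <;> omega

theorem score_le_length (t : Transcript n) (z : Fin n) :
    (attackState r t).score z ≤ t.length := by
  induction t with
  | nil => exact le_rfl
  | cons a t ih =>
    have := score_cons_le (r := r) a t z
    rw [List.length_cons]
    omega

theorem maskOf_subset_cons (a : Finset (Fin n) × Bool) (t : Transcript n) :
    maskOf r t ⊆ maskOf r (a :: t) := by
  obtain ⟨U, Z⟩ := a
  exact subset_mask_foldl_scoreKey _ _ _ _

/-- The margin over the median at which a key is masked in round `i`. -/
def margin (n r i : ℕ) : ℝ := Real.sqrt (i * Real.log (200 * n * r) / 2)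

/-- The exponent `s` of the exponential potential that controls round `i`. It maximizes
`s * margin - i * (25 * s ^ 2 / 204)`, the exponent of the Chernoff bound at the margin. -/
def tilt (n r i : ℕ) : ℝ := 102 / 25 * margin n r i / i

/-- The exponential potential of the pairwise score differences of the keys outside `N₀`. -/
def pairPotential (N₀ : Finset (Fin n)) (s : ℝ) (C : Fin n → ℕ) : ℝ :=
  ∑ x ∈ N₀ᶜ, ∑ y ∈ N₀ᶜ, Real.exp (s * (C x - C y))

/-- The value that the potential reaches when a key outside `N₀` is masked in round `i`. -/
def barrier (n r i : ℕ) : ℝ := n / 4 * Real.exp (tilt n r i * (margin n r i - 1))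

/-- The scores of the keys outside `N₀` were concentrated in all rounds of the transcript: the
potential stayed below the barrier. Rounds whose margin exceeds their number are exempt, as no key
can be masked there. -/
def Concentrated (N₀ : Finset (Fin n)) (r : ℕ) : Transcript n → Prop
  | [] => True
  | a :: t => Concentrated N₀ r t ∧ (margin n r (t.length + 1) ≤ (t.length + 1 : ℕ) →
      pairPotential N₀ (tilt n r (t.length + 1)) (attackState r (a :: t)).score <
        barrier n r (t.length + 1))

theorem margin_mono (h : 0 ≤ Real.log (200 * n * r)) {i j : ℕ} (hij : i ≤ j) :
    margin n r i ≤ margin n r j := by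
  unfold margin
  gcongr

theorem margin_sq (h : 0 ≤ Real.log (200 * n * r)) (i : ℕ) :
    margin n r i ^ 2 = i * Real.log (200 * n * r) / 2 :=
  Real.sq_sqrt (by positivity)

theorem pairPotential_nonneg (N₀ : Finset (Fin n)) (s : ℝ) (C : Fin n → ℕ) :
    0 ≤ pairPotential N₀ s C :=
  Finset.sum_nonneg fun _ _ => Finset.sum_nonneg fun _ _ => (Real.exp_pos _).le

theorem exp_le_pairPotential {N₀ : Finset (Fin n)} {x y : Fin n} (hx : x ∉ N₀) (hy : y ∉ N₀)
    (s : ℝ) (C : Fin n → ℕ) : Real.exp (s * (C x - C y)) ≤ pairPotential N₀ s C := by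
  refine le_trans ?_ (Finset.single_le_sum (s := N₀ᶜ)
    (f := fun x => ∑ y ∈ N₀ᶜ, Real.exp (s * (C x - C y)))
    (fun _ _ => Finset.sum_nonneg fun _ _ => (Real.exp_pos _).le) (Finset.mem_compl.2 hx))
  exact Finset.single_le_sum (s := N₀ᶜ) (f := fun y => Real.exp (s * (C x - C y)))
    (fun _ _ => (Real.exp_pos _).le) (Finset.mem_compl.2 hy)

theorem card_mul_le_pairPotential {N₀ T : Finset (Fin n)} {x : Fin n} (hx : x ∉ N₀)
    (hT : T ⊆ N₀ᶜ) {s a : ℝ} {C : Fin n → ℕ} (h : ∀ y ∈ T, a ≤ s * (C x - C y)) :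
    T.card * Real.exp a ≤ pairPotential N₀ s C := by
  refine le_trans ?_ (Finset.single_le_sum (s := N₀ᶜ)
    (f := fun x => ∑ y ∈ N₀ᶜ, Real.exp (s * (C x - C y)))
    (fun _ _ => Finset.sum_nonneg fun _ _ => (Real.exp_pos _).le) (Finset.mem_compl.2 hx))
  refine le_trans ?_ (Finset.sum_le_sum_of_subset_of_nonneg hT
    fun _ _ _ => (Real.exp_pos _).le)
  rw [← nsmul_eq_mul]
  exact Finset.card_nsmul_le_sum _ _ _ fun y hy => Real.exp_le_exp.2 (h y hy)

theorem tilt_nonneg (i : ℕ) : 0 ≤ tilt n r i := by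
  unfold tilt margin
  positivity

/-- As long as the scores of the keys outside `N₀` are concentrated, none of them is masked: such a
key would exceed at least a quarter of the others by the margin. -/
theorem Concentrated.maskOf_subset {N₀ : Finset (Fin n)} (hN : 1000 * N₀.card ≤ n)
    {t : Transcript n} (ht : Concentrated N₀ r t) : maskOf r t ⊆ N₀ := by
  induction t with
  | nil => exact Finset.empty_subset _
  | cons a t ih =>
    obtain ⟨ht, hpot⟩ := ht
    obtain ⟨U, Z⟩ := a
    have hsc : ∀ z, (attackState r t).score z + (if z ∈ U.sort (· ≤ ·) then Z.toNat else 0) =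
        (attackState r ((U, Z) :: t)).score z := by
      intro z; rw [score_cons]; simp
    refine mask_foldl_scoreKey_subset (lo := (attackState r t).score)
      (hi := (attackState r ((U, Z) :: t)).score) ?_ _ (Finset.sort_nodup _ _) _ (ih ht)
      (fun _ => le_rfl) hsc
    intro C M x hM hlo hhi hCx hmed
    by_contra hx
    change median ((Mᶜ).val.map C) + margin n r (t.length + 1) ≤ (C x : ℝ) at hmed
    have hle : margin n r (t.length + 1) ≤ (t.length + 1 : ℕ) := by
      have h1 : (C x : ℝ) ≤ (t.length + 1 : ℕ) := by
        rw [hCx]; exact_mod_cast score_le_length ((U, Z) :: t) x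
      have h2 := median_nonneg ((Mᶜ).val.map C)
      linarith
    refine absurd (hpot hle) (not_lt.2 ?_)
    set T := (Mᶜ.filter fun y => (C y : ℝ) ≤ median ((Mᶜ).val.map C)) \ N₀ with hT
    have hcount : n / 4 ≤ (T.card : ℝ) := by
      have h1 := card_le_two_mul_card_le_median Mᶜ C
      have h2 := Finset.card_compl_add_card M
      have h3 := Finset.card_le_card hM
      have h4 := Finset.le_card_sdiff N₀ (Mᶜ.filter fun y => (C y : ℝ) ≤ median ((Mᶜ).val.map C))
      rw [← hT] at h4
      rw [Fintype.card_fin] at h2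
      have h5 : n ≤ 4 * T.card := by omega
      have : (n : ℝ) ≤ 4 * T.card := by exact_mod_cast h5
      linarith
    refine le_trans ?_ (card_mul_le_pairPotential (T := T) hx ?_
      (a := tilt n r (t.length + 1) * (margin n r (t.length + 1) - 1)) ?_)
    · unfold barrier
      exact mul_le_mul_of_nonneg_right hcount (Real.exp_pos _).le
    · intro y hy
      rw [Finset.mem_compl]
      exact (Finset.mem_sdiff.1 hy).2
    · intro y hy
      refine mul_le_mul_of_nonneg_left ?_ (tilt_nonneg _)
      have h1 := (Finset.mem_filter.1 (Finset.mem_sdiff.1 hy).1).2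
      have h2 : ((attackState r ((U, Z) :: t)).score y : ℝ) ≤ C y + 1 := by
        exact_mod_cast (score_cons_le (U, Z) t y).trans (Nat.add_le_add_right (hlo y) 1)
      rw [← hCx]
      linarith

/-- Concentration bounds the score differences of the keys outside `N₀` by twice the margin. -/
theorem Concentrated.score_sub_le {N₀ : Finset (Fin n)} (hn : 1 ≤ n) (hr : 1 ≤ r)
    {t : Transcript n} (ht : Concentrated N₀ r t) {x y : Fin n} (hx : x ∉ N₀) (hy : y ∉ N₀) :
    ((attackState r t).score x : ℝ) - (attackState r t).score y ≤ 2 * margin n r t.length := by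
  have hn' : (1 : ℝ) ≤ n := by exact_mod_cast hn
  have hr' : (1 : ℝ) ≤ r := by exact_mod_cast hr
  have hnr : (1 : ℝ) ≤ n * r := by nlinarith
  have hL : 0 < Real.log (200 * n * r) := Real.log_pos (by nlinarith)
  have h0 : (0 : ℝ) ≤ (attackState r t).score y := Nat.cast_nonneg _
  have hlen : ((attackState r t).score x : ℝ) ≤ t.length := by exact_mod_cast score_le_length t x
  have hm0 : 0 ≤ margin n r t.length := Real.sqrt_nonneg _
  rcases t with _ | ⟨a, t⟩
  · simp only [List.length_nil, Nat.cast_zero] at hlen hm0 ⊢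
    linarith
  obtain ⟨ht, hpot⟩ := ht
  rw [List.length_cons] at hlen hm0 ⊢
  set i := t.length + 1 with hi
  by_cases hle : margin n r i ≤ (i : ℕ)
  · have h1 := (exp_le_pairPotential hx hy (tilt n r i) _).trans_lt (hpot hle)
    have hi0 : (0 : ℝ) < i := by rw [hi]; positivity
    have hmsq := margin_sq hL.le i
    have hmpos : 0 < margin n r i := Real.sqrt_pos.2 (by positivity)
    have hs : 0 < tilt n r i := by unfold tilt; positivity
    have hb : barrier n r i ≤ Real.exp (tilt n r i * (2 * margin n r i)) := by
      have h2 : (n : ℝ) / 4 ≤ Real.exp (Real.log (200 * n * r)) := by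
        rw [Real.exp_log (by positivity)]
        nlinarith
      have h3 : Real.log (200 * n * r) ≤ tilt n r i * margin n r i := by
        have : tilt n r i * margin n r i = 102 / 25 * margin n r i ^ 2 / i := by
          unfold tilt; ring
        rw [this, hmsq, le_div_iff₀ hi0]
        nlinarith
      unfold barrier
      calc (n : ℝ) / 4 * Real.exp (tilt n r i * (margin n r i - 1))
          ≤ Real.exp (Real.log (200 * n * r)) * Real.exp (tilt n r i * (margin n r i - 1)) :=
            mul_le_mul_of_nonneg_right h2 (Real.exp_pos _).le
        _ ≤ _ := by
          rw [← Real.exp_add]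
          exact Real.exp_le_exp.2 (by nlinarith)
    have h2 := Real.exp_lt_exp.1 (h1.trans_le hb)
    exact (lt_of_mul_lt_mul_left h2 hs.le).le
  · rw [not_le] at hle
    linarith

/-- As long as the scores of the keys outside `N₀` are concentrated, the unmasked keys of `N₀` do
not get far ahead of them. -/
theorem Concentrated.score_sub_le_of_notMem {N₀ : Finset (Fin n)} (hN : 1000 * N₀.card ≤ n)
    (hn : 1 ≤ n) (hr : 1 ≤ r) {t : Transcript n} (ht : Concentrated N₀ r t) (hlen : t.length ≤ r)
    {x y : Fin n} (hx : x ∉ maskOf r t) (hy : y ∉ N₀) :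
    ((attackState r t).score x : ℝ) - (attackState r t).score y ≤ 3 * margin n r r := by
  have hn' : (1 : ℝ) ≤ n := by exact_mod_cast hn
  have hr' : (1 : ℝ) ≤ r := by exact_mod_cast hr
  have hnr : (1 : ℝ) ≤ n * r := by nlinarith
  have hL : 0 < Real.log (200 * n * r) := Real.log_pos (by nlinarith)
  induction t with
  | nil =>
    have hm0 : 0 ≤ margin n r r := Real.sqrt_nonneg _
    simp only [attackState, Nat.cast_zero]
    linarith
  | cons a t ih =>
    have htc := ht
    obtain ⟨ht, -⟩ := ht
    rw [List.length_cons] at hlen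
    obtain ⟨U, Z⟩ := a
    by_cases hxU : x ∈ U
    · have hsc : ∀ z, (attackState r t).score z + (if z ∈ U.sort (· ≤ ·) then Z.toNat else 0) =
          (attackState r ((U, Z) :: t)).score z := by
        intro z; rw [score_cons]; simp
      obtain ⟨C, M, hM, hC, hCx, hlt⟩ := exists_lt_of_notMem_mask_foldl_scoreKey
        (U.sort (· ≤ ·)) (Finset.sort_nodup _ _) (by simpa using hxU) (attackState r t) hx hsc
      change (C x : ℝ) < median ((Mᶜ).val.map C) + margin n r (t.length + 1) at hlt
      have hMN : M ⊆ N₀ := hM.trans (htc.maskOf_subset hN)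
      -- More than half of the keys are outside `N₀`, so the median is exceeded by one of them.
      obtain ⟨z, hz, hzN⟩ : ∃ z, median ((Mᶜ).val.map C) ≤ (C z : ℝ) ∧ z ∉ N₀ := by
        by_contra hcon
        push Not at hcon
        have h1 := card_le_two_mul_card_median_le Mᶜ C
        have h2 := Finset.card_compl_add_card M
        have h3 := Finset.card_le_card hMN
        rw [Fintype.card_fin] at h2
        have h4 : (Mᶜ.filter fun y => median ((Mᶜ).val.map C) ≤ (C y : ℝ)).card ≤ N₀.card :=
          Finset.card_le_card fun y hy => hcon y (Finset.mem_filter.1 hy).2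
        omega
      have h5 := htc.score_sub_le hn hr hzN hy
      rw [List.length_cons] at h5
      have h6 := margin_mono hL.le hlen
      have h7 : (C z : ℝ) ≤ (attackState r ((U, Z) :: t)).score z := by exact_mod_cast hC z
      rw [← hCx]
      linarith
    · have h1 := ih ht (by omega) (fun h => hx (maskOf_subset_cons _ _ h))
      have h2 : (attackState r ((U, Z) :: t)).score x = (attackState r t).score x := by
        rw [score_cons, if_neg hxU, add_zero]
      have h3 : ((attackState r t).score y : ℝ) ≤ (attackState r ((U, Z) :: t)).score y := by
        exact_mod_cast score_le_score_cons _ _ _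
      rw [h2]
      linarith

/-! ### The score advantage of a key -/

/-- The fraction of the keys outside `N₀` that belong to `U`. -/
def outsideRate (N₀ U : Finset (Fin n)) : ℝ := (∑ y ∈ N₀ᶜ, ind y U) / (N₀ᶜ.card : ℝ)

/-- The advantage of the score of `x` over the mean score of the keys outside `N₀`, frozen when `x`
is masked. -/
def advantage (N₀ : Finset (Fin n)) (r : ℕ) (x : Fin n) : Transcript n → ℝ
  | [] => 0
  | (U, Z) :: t => advantage N₀ r x t +
      if x ∈ maskOf r t then 0 else (Z.toNat : ℝ) * (ind x U - outsideRate N₀ U)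

theorem advantage_eq {N₀ : Finset (Fin n)} {x : Fin n} {t : Transcript n} (hx : x ∉ maskOf r t) :
    advantage N₀ r x t = (attackState r t).score x -
      (∑ y ∈ N₀ᶜ, ((attackState r t).score y : ℝ)) / (N₀ᶜ.card : ℝ) := by
  induction t with
  | nil => simp [advantage, attackState]
  | cons a t ih =>
    obtain ⟨U, Z⟩ := a
    have hx' : x ∉ maskOf r t := fun h => hx (maskOf_subset_cons _ _ h)
    have e : ∀ z, (((attackState r ((U, Z) :: t)).score z : ℕ) : ℝ) =
        (attackState r t).score z + Z.toNat * ind z U := by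
      intro z
      rw [score_cons]
      unfold ind
      split_ifs <;> simp
    rw [advantage, ih hx', if_neg hx']
    simp only [e]
    rw [Finset.sum_add_distrib, ← Finset.mul_sum]
    unfold outsideRate
    ring

theorem ind_nonneg (x : Fin n) (U : Finset (Fin n)) : 0 ≤ ind x U := by
  unfold ind; split_ifs <;> norm_num

theorem ind_le_one (x : Fin n) (U : Finset (Fin n)) : ind x U ≤ 1 := by
  unfold ind; split_ifs <;> norm_num

theorem outsideRate_nonneg (N₀ U : Finset (Fin n)) : 0 ≤ outsideRate N₀ U :=
  div_nonneg (Finset.sum_nonneg fun _ _ => ind_nonneg _ _) (Nat.cast_nonneg _)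

theorem outsideRate_le_one (N₀ U : Finset (Fin n)) : outsideRate N₀ U ≤ 1 := by
  refine div_le_one_of_le₀ ?_ (Nat.cast_nonneg _)
  calc ∑ y ∈ N₀ᶜ, ind y U ≤ ∑ y ∈ N₀ᶜ, (1 : ℝ) := Finset.sum_le_sum fun _ _ => ind_le_one _ _
    _ = _ := by simp

theorem advantage_cons_le (N₀ : Finset (Fin n)) (x : Fin n) (a : Finset (Fin n) × Bool)
    (t : Transcript n) : advantage N₀ r x (a :: t) ≤ advantage N₀ r x t + 1 := by
  obtain ⟨U, Z⟩ := a
  rw [advantage]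
  have h1 := ind_le_one x U
  have h2 := outsideRate_nonneg N₀ U
  split_ifs
  · linarith
  · cases Z
    · simp
    · simp only [Bool.toNat_true, Nat.cast_one, one_mul]
      linarith

theorem Concentrated.advantage_le {N₀ : Finset (Fin n)} (hN : 1000 * N₀.card ≤ n) (hn : 1 ≤ n)
    (hr : 1 ≤ r) {t : Transcript n} (ht : Concentrated N₀ r t) (hlen : t.length ≤ r) (x : Fin n) :
    advantage N₀ r x t ≤ 3 * margin n r r + 1 := by
  have hm0 : 0 ≤ margin n r r := Real.sqrt_nonneg _
  have hunm : ∀ t : Transcript n, Concentrated N₀ r t → t.length ≤ r → x ∉ maskOf r t →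
      advantage N₀ r x t ≤ 3 * margin n r r := by
    intro t ht hlen hx
    have hc : 0 < N₀ᶜ.card := by
      have := Finset.card_compl_add_card N₀
      rw [Fintype.card_fin] at this
      omega
    have hc' : (0 : ℝ) < N₀ᶜ.card := by exact_mod_cast hc
    have : (∑ y ∈ N₀ᶜ, (((attackState r t).score x : ℝ) - 3 * margin n r r)) ≤
        ∑ y ∈ N₀ᶜ, ((attackState r t).score y : ℝ) :=
      Finset.sum_le_sum fun y hy => by
        have := ht.score_sub_le_of_notMem hN hn hr hlen hx (Finset.mem_compl.1 hy)
        linarith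
    rw [Finset.sum_const, nsmul_eq_mul, mul_comm, ← le_div_iff₀ hc'] at this
    rw [advantage_eq hx]
    linarith
  induction t with
  | nil => simp only [advantage]; linarith
  | cons a t ih =>
    have htc := ht
    obtain ⟨ht, -⟩ := ht
    have hlen' : t.length ≤ r := by rw [List.length_cons] at hlen; omega
    by_cases hx : x ∈ maskOf r t
    · obtain ⟨U, Z⟩ := a
      rw [advantage, if_pos hx, add_zero]
      exact ih ht hlen'
    · have := hunm t ht hlen' hx
      have := advantage_cons_le (r := r) N₀ x a t
      linarith

end Transcripts

/-! ### The expected effect of one round -/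

section OneRound

variable {n : ℕ} {Sk : Type}

/-- The sampled set `U` is misleading if the sketch of some `M ∪ U` with `M ⊆ N₀` depends on keys
of `U` outside `N₀`. -/
def Misleading (S : Finset (Fin n) → Sk) (N₀ U : Finset (Fin n)) : Prop :=
  ∃ M ⊆ N₀, S (M ∪ U) ≠ S (M ∪ (U ∩ N₀))

open Classical in
/-- The keys of `N₀` determine the sketch up to a failure probability `ε`, at all sampling rates
that occur. -/
def Determines (S : Finset (Fin n) → Sk) (N₀ : Finset (Fin n)) (ε : ℝ) : Prop :=
  ∀ q : ℝ, 1 / 20 ≤ q → q ≤ 1 / 4 →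
    binExp q (fun U => if Misleading S N₀ U then 1 else 0) ≤ ε

variable {S : Finset (Fin n) → Sk} {N₀ M : Finset (Fin n)} {ε δ : ℝ} {π : Sk → unitInterval}

theorem ignores_of_notMem (M N₀ : Finset (Fin n)) (S : Finset (Fin n) → Sk) (π : Sk → unitInterval)
    {x : Fin n} (hx : x ∉ N₀ \ M) :
    Ignores (fun U => (π (S (M ∪ (U ∩ N₀))) : ℝ)) x := by
  intro U
  have : M ∪ (insert x U ∩ N₀) = M ∪ (U ∩ N₀) := by
    ext z
    rw [Finset.mem_sdiff] at hx
    by_cases hz : z = x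
    · subst hz
      simp only [Finset.mem_union, Finset.mem_inter, Finset.mem_insert]
      tauto
    · simp [hz]
  simp only [this]

open Classical in
theorem abs_sub_le_misleading (hM : M ⊆ N₀) (U : Finset (Fin n)) :
    |(π (S (M ∪ U)) : ℝ) - π (S (M ∪ (U ∩ N₀)))| ≤ if Misleading S N₀ U then 1 else 0 := by
  split_ifs with h
  · rw [abs_le]
    have h1 := (π (S (M ∪ U))).2
    have h2 := (π (S (M ∪ (U ∩ N₀)))).2
    constructor <;> linarith [h1.1, h1.2, h2.1, h2.2]
  · have : S (M ∪ U) = S (M ∪ (U ∩ N₀)) := by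
      by_contra hne
      exact h ⟨M, hM, hne⟩
    rw [this, sub_self, abs_zero]

/-- Replacing the response by the one to the query restricted to `N₀` changes expectations by
little. -/
theorem Determines.abs_binExp_sub_le (hD : Determines S N₀ ε) (hM : M ⊆ N₀) {q : ℝ}
    (h0 : 1 / 20 ≤ q) (h1 : q ≤ 1 / 4) {c : ℝ} {g : Finset (Fin n) → ℝ} (hg : ∀ U, |g U| ≤ c) :
    |binExp q (fun U => (π (S (M ∪ U)) : ℝ) * g U) -
      binExp q (fun U => (π (S (M ∪ (U ∩ N₀))) : ℝ) * g U)| ≤ c * ε := by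
  classical
  have hc : 0 ≤ c := (abs_nonneg _).trans (hg ∅)
  have hb : ∀ U, |(π (S (M ∪ U)) : ℝ) * g U - (π (S (M ∪ (U ∩ N₀))) : ℝ) * g U| ≤
      c * if Misleading S N₀ U then 1 else 0 := by
    intro U
    rw [← sub_mul, abs_mul, mul_comm]
    exact mul_le_mul (hg U) (abs_sub_le_misleading hM U) (abs_nonneg _) hc
  have hd := mul_le_mul_of_nonneg_left (hD q h0 h1) hc
  rw [← binExp_mul_left] at hd
  rw [← binExp_sub, abs_le]
  constructor
  · refine le_trans (neg_le_neg hd) ?_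
    rw [neg_eq_neg_one_mul, ← binExp_mul_left]
    refine binExp_mono (by linarith) (by linarith) fun U => ?_
    have := (abs_le.1 (hb U)).1
    linarith
  · refine le_trans ?_ hd
    exact binExp_mono (by linarith) (by linarith) fun U => (abs_le.1 (hb U)).2

/-- The keys outside `N₀` are exchangeable, up to `ε`, so that the exponential moment of the
difference of two of their scores grows at most by this factor in a round. -/
theorem Determines.exp_moment_le (hD : Determines S N₀ ε) (hM : M ⊆ N₀) {x y : Fin n} (hx : x ∉ N₀)
    (hy : y ∉ N₀) {s : ℝ} (hs0 : 0 ≤ s) (hs5 : s ≤ 5) (hε : 0 ≤ ε) :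
    ∑ U, sampleWeight U * (π (S (M ∪ U)) * Real.exp (s * (ind x U - ind y U)) +
      (1 - π (S (M ∪ U)))) ≤ Real.exp (25 * s ^ 2 / 204 + ε * Real.exp 5) := by
  have hρ : 1 ≤ Real.exp (25 * s ^ 2 / 204 + ε * Real.exp 5) := by
    rw [Real.one_le_exp_iff]; positivity
  by_cases hxy : x = y
  · subst hxy
    refine le_trans (le_of_eq ?_) hρ
    simp only [sub_self, mul_zero, Real.exp_zero, mul_one, add_sub_cancel]
    exact sum_sampleWeight n
  rw [sum_sampleWeight_mul]
  have hcosh : 0 ≤ Real.cosh s - 1 := by linarith [Real.one_le_cosh s]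
  have hb : ∀ U : Finset (Fin n), |Real.exp (s * (ind x U - ind y U)) - 1| ≤ Real.exp 5 := by
    intro U
    have h1 := ind_nonneg x U
    have h2 := ind_nonneg y U
    have h3 := ind_le_one x U
    have h4 := ind_le_one y U
    have h5 : Real.exp (s * (ind x U - ind y U)) ≤ Real.exp 5 := Real.exp_le_exp.2 (by nlinarith)
    have h6 := Real.exp_pos (s * (ind x U - ind y U))
    have h7 : 1 ≤ Real.exp 5 := Real.one_le_exp (by norm_num)
    rw [abs_le]
    constructor <;> linarith
  have hpt : rateExp (fun q => binExp q fun U =>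
      π (S (M ∪ U)) * Real.exp (s * (ind x U - ind y U)) + (1 - π (S (M ∪ U)))) ≤
      rateExp fun q => 2 * (Real.cosh s - 1) * (q * (1 - q)) + (1 + Real.exp 5 * ε) := by
    refine rateExp_mono (continuous_binExp _) (by fun_prop) fun q h0 h1 => ?_
    have e : binExp q (fun U => π (S (M ∪ U)) * Real.exp (s * (ind x U - ind y U)) +
        (1 - π (S (M ∪ U)))) =
        1 + binExp q (fun U => π (S (M ∪ U)) * (Real.exp (s * (ind x U - ind y U)) - 1)) := by
      rw [← binExp_const (n := n) (q := q) 1, ← binExp_add]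
      congr 1
      funext U
      rw [binExp_const]
      ring
    have h2 := (abs_le.1 (hD.abs_binExp_sub_le (π := π) hM h0 h1 hb)).2
    have hq0 : 0 ≤ q := by linarith
    have hq1 : q ≤ 1 := by linarith
    rw [binExp_mul_exp_ind_sub (ignores_of_notMem M N₀ S π fun h => hx (Finset.mem_sdiff.1 h).1)
      (ignores_of_notMem M N₀ S π fun h => hy (Finset.mem_sdiff.1 h).1) hxy] at h2
    have h3 : binExp q (fun U => (π (S (M ∪ (U ∩ N₀))) : ℝ)) ≤ 1 := by
      have := binExp_mono hq0 hq1 (g := fun U => (π (S (M ∪ (U ∩ N₀))) : ℝ)) (h := fun _ => 1)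
        fun U => (π _).2.2
      rwa [binExp_const] at this
    have h4 : 2 * (q * (1 - q)) * (Real.cosh s - 1) *
        binExp q (fun U => (π (S (M ∪ (U ∩ N₀))) : ℝ)) ≤ 2 * (q * (1 - q)) * (Real.cosh s - 1) :=
      mul_le_of_le_one_right
        (mul_nonneg (mul_nonneg two_pos.le (mul_nonneg hq0 (by linarith))) hcosh) h3
    rw [e]
    linarith
  refine hpt.trans ?_
  rw [rateExp_add (by fun_prop) continuous_const, rateExp_const_mul, rateExp_const, Real.exp_add]
  have h1 := rateExp_mul_one_sub_le
  have h2 := one_add_mul_cosh_sub_one_le s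
  have h3 := Real.add_one_le_exp (ε * Real.exp 5)
  have h4 : 1 ≤ Real.exp (25 * s ^ 2 / 204) := by
    rw [Real.one_le_exp_iff]; positivity
  have h5 : 0 ≤ ε * Real.exp 5 := by positivity
  have h6 := mul_le_mul_of_nonneg_left h1 (by linarith : 0 ≤ 2 * (Real.cosh s - 1))
  nlinarith

/-- In a round with a correct map, the unmasked keys of `N₀` gain in total at least a constant over
the keys outside `N₀`. -/
theorem Determines.le_sum_advantage (hD : Determines S N₀ ε) (hM : M ⊆ N₀)
    (hN : 1000 * N₀.card ≤ n) (hn : 10 ^ 7 ≤ n) (hδ : 0 ≤ δ) (hδ1 : δ ≤ 1 / 1000)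
    (hε : ε ≤ 1 / 1000) (hεN : N₀.card * ε ≤ 1 / 100)
    (hπ : IsCorrect S (threshold n) δ (queryDist M) π) :
    2 / 5 ≤ ∑ U, sampleWeight U *
      (π (S (M ∪ U)) * ∑ x ∈ N₀ \ M, (ind x U - outsideRate N₀ U)) := by
  have hn' : (10 : ℝ) ^ 7 ≤ n := by exact_mod_cast hn
  have hn0 : (0 : ℝ) < n := by linarith [show (0 : ℝ) < 10 ^ 7 by norm_num]
  have hMn : (M.card : ℝ) ≤ n / 1000 := by
    have h1 := Finset.card_le_card hM
    have h2 : 1000 * M.card ≤ n := by omega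
    have : (1000 : ℝ) * M.card ≤ n := by exact_mod_cast h2
    linarith
  have hNc : 0 < N₀ᶜ.card := by
    have := Finset.card_compl_add_card N₀
    rw [Fintype.card_fin] at this
    omega
  have hNc' : (N₀ᶜ.card : ℝ) ≠ 0 := by exact_mod_cast hNc.ne'
  rw [sum_sampleWeight_mul]
  set g : Finset (Fin n) → ℝ := fun U => (π (S (M ∪ (U ∩ N₀))) : ℝ) with hg
  have hclose : ∀ q, 1 / 20 ≤ q → q ≤ 1 / 4 →
      |binExp q (fun U => (π (S (M ∪ U)) : ℝ)) - binExp q g| ≤ ε := by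
    intro q h0 h1
    have := hD.abs_binExp_sub_le (π := π) hM h0 h1 (c := 1) (g := fun _ => 1) (by simp)
    simpa using this
  have hvar : ∀ q : ℝ, q * (1 - q) ≤ 1 / 4 := fun q => by nlinarith [sq_nonneg (q - 1 / 2)]
  have hmain : 44 / 100 ≤ rateExp fun q => ∑ x, binExp q fun U => g U * (ind x U - q) := by
    refine le_rateExp_sum_correlation (fun U => (π _).2.1) ?_ ?_
    · intro q h0 h1
      have h2 := hπ.le_binExp hδ (q := q) (by linarith) (by linarith)
      have h3 := (abs_le.1 (hclose q (by linarith) h1)).2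
      have h4 := binExp_chebyshev (n := n) (q := q) (by linarith) (by linarith)
        (p := fun U => (U.card : ℝ) ≤ n / 8) (a := n / 120) (by positivity) (fun U hU => by
          rw [abs_sub_comm]
          refine le_trans ?_ (le_abs_self _)
          nlinarith)
      have h5 : n * (q * (1 - q)) / ((n : ℝ) / 120) ^ 2 ≤ 1 / 1000 := by
        rw [div_le_iff₀ (by positivity)]
        have := hvar q
        nlinarith
      linarith
    · intro q h0 h1
      have h2 := hπ.binExp_le hδ (q := q) (by linarith) (by linarith)
      have h3 := (abs_le.1 (hclose q h0 (by linarith))).1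
      have h4 := binExp_chebyshev (n := n) (q := q) (by linarith) (by linarith)
        (p := fun U => (n : ℝ) / 16 ≤ M.card + U.card) (a := n / 200) (by positivity)
        (fun U hU => by
          refine le_trans ?_ (le_abs_self _)
          nlinarith)
      have h5 : n * (q * (1 - q)) / ((n : ℝ) / 200) ^ 2 ≤ 1 / 1000 := by
        rw [div_le_iff₀ (by positivity)]
        have := hvar q
        nlinarith
      linarith
  have hpt : ∀ q, 1 / 20 ≤ q → q ≤ 1 / 4 →
      (∑ x, binExp q fun U => g U * (ind x U - q)) + -(N₀.card * ε) ≤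
      binExp q fun U => π (S (M ∪ U)) * ∑ x ∈ N₀ \ M, (ind x U - outsideRate N₀ U) := by
    intro q h0 h1
    have hb : ∀ U, |∑ x ∈ N₀ \ M, (ind x U - outsideRate N₀ U)| ≤ (N₀.card : ℝ) := by
      intro U
      refine (Finset.abs_sum_le_sum_abs _ _).trans ?_
      have h2 : ∑ x ∈ N₀ \ M, |ind x U - outsideRate N₀ U| ≤ ∑ x ∈ N₀ \ M, (1 : ℝ) := by
        refine Finset.sum_le_sum fun x _ => ?_
        have a1 := ind_nonneg x U
        have a2 := ind_le_one x U
        have a3 := outsideRate_nonneg N₀ U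
        have a4 := outsideRate_le_one N₀ U
        rw [abs_le]
        constructor <;> linarith
      refine h2.trans ?_
      rw [Finset.sum_const, nsmul_eq_mul, mul_one]
      exact_mod_cast Finset.card_le_card Finset.sdiff_subset
    have h2 := (abs_le.1 (hD.abs_binExp_sub_le (π := π) hM h0 h1 hb)).1
    have hrate : binExp q (fun U => g U * (outsideRate N₀ U - q)) = 0 := by
      have e : (fun U => g U * (outsideRate N₀ U - q)) =
          fun U => (N₀ᶜ.card : ℝ)⁻¹ * ∑ y ∈ N₀ᶜ, g U * (ind y U - q) := by
        funext U
        rw [← Finset.mul_sum, Finset.sum_sub_distrib, Finset.sum_const, nsmul_eq_mul]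
        unfold outsideRate
        field_simp
      rw [e, binExp_mul_left, binExp_sum, Finset.sum_eq_zero, mul_zero]
      intro y hy
      exact binExp_mul_ind_sub (ignores_of_notMem M N₀ S π fun h =>
        (Finset.mem_compl.1 hy) (Finset.mem_sdiff.1 h).1)
    have e2 : binExp q (fun U => g U * ∑ x ∈ N₀ \ M, (ind x U - outsideRate N₀ U)) =
        ∑ x, binExp q fun U => g U * (ind x U - q) := by
      have e3 : (fun U => g U * ∑ x ∈ N₀ \ M, (ind x U - outsideRate N₀ U)) =
          fun U => ∑ x ∈ N₀ \ M, (g U * (ind x U - q) - g U * (outsideRate N₀ U - q)) := by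
        funext U
        rw [Finset.mul_sum]
        exact Finset.sum_congr rfl fun x _ => by ring
      rw [e3, binExp_sum]
      simp only [binExp_sub, hrate, sub_zero]
      refine Finset.sum_subset (Finset.subset_univ _) fun x _ hx => ?_
      exact binExp_mul_ind_sub (ignores_of_notMem M N₀ S π hx)
    rw [e2] at h2
    linarith
  have hc1 : Continuous fun q => ∑ x, binExp q fun U => g U * (ind x U - q) := by
    refine continuous_finsetSum _ fun x _ => ?_
    unfold binExp
    fun_prop
  have := rateExp_mono (hc1.fun_add continuous_const) (continuous_binExp _) hpt
  rw [rateExp_add hc1 continuous_const, rateExp_const] at this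
  linarith

end OneRound

/-! ### Expectations along the attack -/

section AttackProbability

/-- The expectation of a nonnegative function of a discrete random variable. -/
def mean {β : Type*} (p : PMF β) (φ : β → ℝ≥0∞) : ℝ≥0∞ := ∑' a, p a * φ a

section mean

variable {β γ : Type*}

theorem mean_pure (a : β) (φ : β → ℝ≥0∞) : mean (PMF.pure a) φ = φ a := by
  unfold mean
  rw [tsum_eq_single a]
  · simp
  · intro b hb; simp [PMF.pure_apply, hb]

theorem mean_bind (p : PMF β) (f : β → PMF γ) (φ : γ → ℝ≥0∞) :
    mean (p.bind f) φ = mean p fun a => mean (f a) φ := by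
  unfold mean
  simp only [PMF.bind_apply, ← ENNReal.tsum_mul_right, ← ENNReal.tsum_mul_left]
  rw [ENNReal.tsum_comm]
  simp only [mul_assoc]

theorem mean_map (p : PMF β) (f : β → γ) (φ : γ → ℝ≥0∞) :
    mean (p.map f) φ = mean p fun a => φ (f a) := by
  rw [← PMF.bind_pure_comp, mean_bind]
  simp only [Function.comp_apply, mean_pure]

theorem mean_mono_of_support (p : PMF β) {φ ψ : β → ℝ≥0∞} (h : ∀ a ∈ p.support, φ a ≤ ψ a) :
    mean p φ ≤ mean p ψ := by
  refine ENNReal.tsum_le_tsum fun a => ?_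
  by_cases ha : p a = 0
  · simp [ha]
  · exact mul_le_mul_right (h a ha) _

theorem mean_add (p : PMF β) (φ ψ : β → ℝ≥0∞) :
    mean p (fun a => φ a + ψ a) = mean p φ + mean p ψ := by
  unfold mean
  simp only [mul_add]
  exact ENNReal.tsum_add

theorem mean_mul_left (p : PMF β) (c : ℝ≥0∞) (φ : β → ℝ≥0∞) :
    mean p (fun a => c * φ a) = c * mean p φ := by
  unfold mean
  rw [← ENNReal.tsum_mul_left]
  exact tsum_congr fun a => by ring

theorem mean_const (p : PMF β) (c : ℝ≥0∞) : mean p (fun _ => c) = c := by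
  unfold mean
  rw [ENNReal.tsum_mul_right, PMF.tsum_coe, one_mul]

end mean

variable {n : ℕ} {Sk : Type} {S : Finset (Fin n) → Sk} {δ : ℝ} {r : ℕ}

theorem mean_bern (p : unitInterval) (φ : Bool → ℝ≥0∞) :
    mean (bern p) φ = ENNReal.ofReal p * φ true + ENNReal.ofReal (1 - p) * φ false := by
  unfold mean
  rw [tsum_fintype, Fintype.sum_bool]
  rfl

theorem mean_attackStep_of_not (qr : QueryResponder S δ r) {t : Transcript n}
    (h : ¬ CorrectMapExists S δ (maskOf r t)) (φ : Transcript n → ℝ≥0∞) :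
    mean (attackStep qr t) φ = φ t := by
  unfold attackStep
  rw [if_neg h, mean_pure]

/-- The expectation over one round in which a correct map exists. -/
theorem mean_attackStep_le (qr : QueryResponder S δ r) {t : Transcript n}
    (h : CorrectMapExists S δ (maskOf r t)) {φ : Transcript n → ℝ≥0∞}
    {g : Finset (Fin n) × Bool → ℝ} (hg : ∀ a, 0 ≤ g a)
    (hφ : ∀ a, φ (a :: t) ≤ ENNReal.ofReal (g a)) :
    mean (attackStep qr t) φ ≤ ENNReal.ofReal (∑ U, sampleWeight U *
      (qr.select t (S (maskOf r t ∪ U)) * g (U, true) +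
        (1 - qr.select t (S (maskOf r t ∪ U))) * g (U, false))) := by
  unfold attackStep
  rw [if_pos h, mean_bind]
  simp only [mean_map, mean_bern]
  unfold mean
  rw [tsum_fintype, ENNReal.ofReal_sum_of_nonneg]
  · refine Finset.sum_le_sum fun U _ => ?_
    have hp := (qr.select t (S (maskOf r t ∪ U))).2
    rw [ENNReal.ofReal_mul (sampleWeight_nonneg U),
      ENNReal.ofReal_add (mul_nonneg hp.1 (hg _)) (mul_nonneg (by linarith [hp.2]) (hg _)),
      ENNReal.ofReal_mul hp.1, ENNReal.ofReal_mul (by linarith [hp.2])]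
    refine mul_le_mul_right (add_le_add ?_ ?_) _
    · exact mul_le_mul_right (hφ _) _
    · exact mul_le_mul_right (hφ _) _
  · intro U _
    have hp := (qr.select t (S (maskOf r t ∪ U))).2
    exact mul_nonneg (sampleWeight_nonneg U)
      (add_nonneg (mul_nonneg hp.1 (hg _)) (mul_nonneg (by linarith [hp.2]) (hg _)))

theorem exists_cons_of_mem_support (qr : QueryResponder S δ r) {t t' : Transcript n}
    (h : CorrectMapExists S δ (maskOf r t)) (ht' : t' ∈ (attackStep qr t).support) :
    ∃ a, t' = a :: t := by
  unfold attackStep at ht'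
  rw [if_pos h, PMF.mem_support_bind_iff] at ht'
  obtain ⟨U, -, hU⟩ := ht'
  rw [PMF.mem_support_map_iff] at hU
  obtain ⟨Z, -, rfl⟩ := hU
  exact ⟨(U, Z), rfl⟩

/-- A transcript is as long as the number of rounds, unless the attack has exited. -/
theorem length_of_mem_support (qr : QueryResponder S δ r) (i : ℕ) {t : Transcript n}
    (ht : t ∈ (attackRun qr i).support) :
    t.length ≤ i ∧ (CorrectMapExists S δ (maskOf r t) → t.length = i) := by
  induction i generalizing t with
  | zero =>
    rw [attackRun, PMF.support_pure, Set.mem_singleton_iff] at ht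
    subst ht
    exact ⟨le_rfl, fun _ => rfl⟩
  | succ i ih =>
    rw [attackRun, PMF.mem_support_bind_iff] at ht
    obtain ⟨t₀, h₀, ht⟩ := ht
    by_cases hc : CorrectMapExists S δ (maskOf r t₀)
    · obtain ⟨a, rfl⟩ := exists_cons_of_mem_support qr hc ht
      have := (ih h₀).2 hc
      rw [List.length_cons]
      exact ⟨by omega, fun _ => by omega⟩
    · unfold attackStep at ht
      rw [if_neg hc, PMF.support_pure, Set.mem_singleton_iff] at ht
      subst ht
      exact ⟨(ih h₀).1.trans (Nat.le_succ _), fun h => absurd h hc⟩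

variable {N₀ : Finset (Fin n)} {ε : ℝ}

theorem Concentrated.tail {t : Transcript n} (ht : Concentrated N₀ r t) :
    Concentrated N₀ r t.tail := by
  cases t with
  | nil => exact ht
  | cons a t => exact ht.1

/-! ### Concentration of the scores outside `N₀` -/

open Classical in
/-- The potential of a transcript of `i` rounds, unless concentration failed before. -/
def stoppedPotential (N₀ : Finset (Fin n)) (r : ℕ) (s : ℝ) (i : ℕ) (t : Transcript n) : ℝ≥0∞ :=
  if t.length = i ∧ Concentrated N₀ r t.tail then
    ENNReal.ofReal (pairPotential N₀ s (attackState r t).score) else 0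

/-- The growth of the potential in one round. -/
theorem mean_attackStep_stoppedPotential_le (qr : QueryResponder S δ r) (hD : Determines S N₀ ε)
    (hε : 0 ≤ ε) (hN : 1000 * N₀.card ≤ n) {s : ℝ} (hs0 : 0 ≤ s) (hs5 : s ≤ 5) {i : ℕ}
    {t : Transcript n} (hti : t.length ≤ i) :
    mean (attackStep qr t) (stoppedPotential N₀ r s (i + 1)) ≤
      ENNReal.ofReal (Real.exp (25 * s ^ 2 / 204 + ε * Real.exp 5)) *
        stoppedPotential N₀ r s i t := by
  by_cases hc : CorrectMapExists S δ (maskOf r t)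
  · by_cases hcon : t.length = i ∧ Concentrated N₀ r t
    · have hφ : ∀ a, stoppedPotential N₀ r s (i + 1) (a :: t) ≤
          ENNReal.ofReal (pairPotential N₀ s (attackState r (a :: t)).score) := by
        intro a
        unfold stoppedPotential
        split_ifs <;> simp
      refine (mean_attackStep_le qr hc (fun a => pairPotential_nonneg _ _ _) hφ).trans ?_
      have hM := hcon.2.maskOf_subset hN
      unfold stoppedPotential
      rw [if_pos ⟨hcon.1, hcon.2.tail⟩, ← ENNReal.ofReal_mul (Real.exp_pos _).le]
      refine ENNReal.ofReal_le_ofReal ?_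
      set π := qr.select t
      set M := maskOf r t
      set C := (attackState r t).score
      have e : ∀ U, sampleWeight U *
          ((π (S (M ∪ U)) : ℝ) * pairPotential N₀ s (attackState r ((U, true) :: t)).score +
            (1 - π (S (M ∪ U))) * pairPotential N₀ s (attackState r ((U, false) :: t)).score) =
          ∑ x ∈ N₀ᶜ, ∑ y ∈ N₀ᶜ, Real.exp (s * (C x - C y)) * (sampleWeight U *
            (π (S (M ∪ U)) * Real.exp (s * (ind x U - ind y U)) + (1 - π (S (M ∪ U))))) := by
        intro U
        unfold pairPotential
        simp only [Finset.mul_sum, ← Finset.sum_add_distrib]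
        refine Finset.sum_congr rfl fun x _ => Finset.sum_congr rfl fun y _ => ?_
        have e1 : ∀ z, (((attackState r ((U, true) :: t)).score z : ℕ) : ℝ) = C z + ind z U := by
          intro z
          rw [score_cons]
          unfold ind
          split_ifs <;> simp [C]
        have e2 : ∀ z, (((attackState r ((U, false) :: t)).score z : ℕ) : ℝ) = C z := by
          intro z
          rw [score_cons]
          simp [C]
        rw [e1, e1, e2, e2]
        have e3 : s * ((C x : ℝ) + ind x U - (C y + ind y U)) =
            s * (C x - C y) + s * (ind x U - ind y U) := by ring
        rw [e3, Real.exp_add]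
        ring
      simp only [e]
      rw [Finset.sum_comm]
      unfold pairPotential
      rw [Finset.mul_sum]
      refine Finset.sum_le_sum fun x hx => ?_
      rw [Finset.sum_comm, Finset.mul_sum]
      refine Finset.sum_le_sum fun y hy => ?_
      rw [← Finset.mul_sum, mul_comm]
      exact mul_le_mul_of_nonneg_right (hD.exp_moment_le hM (Finset.mem_compl.1 hx)
        (Finset.mem_compl.1 hy) hs0 hs5 hε) (Real.exp_pos _).le
    · refine (mean_mono_of_support _ (ψ := fun _ => 0) fun t' ht' => ?_).trans ?_
      · obtain ⟨a, rfl⟩ := exists_cons_of_mem_support qr hc ht'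
        unfold stoppedPotential
        rw [if_neg]
        rw [List.length_cons, List.tail_cons]
        exact fun h => hcon ⟨by omega, h.2⟩
      · rw [mean_const]; exact zero_le
  · rw [mean_attackStep_of_not qr hc]
    have : stoppedPotential N₀ r s (i + 1) t = 0 := by
      unfold stoppedPotential
      rw [if_neg]
      exact fun h => by omega
    rw [this]
    exact zero_le

theorem mean_attackRun_stoppedPotential_le (qr : QueryResponder S δ r) (hD : Determines S N₀ ε)
    (hε : 0 ≤ ε) (hN : 1000 * N₀.card ≤ n) {s : ℝ} (hs0 : 0 ≤ s) (hs5 : s ≤ 5) (i : ℕ) :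
    mean (attackRun qr i) (stoppedPotential N₀ r s i) ≤
      ENNReal.ofReal (Real.exp (25 * s ^ 2 / 204 + ε * Real.exp 5) ^ i * n ^ 2) := by
  induction i with
  | zero =>
    rw [attackRun, mean_pure]
    unfold stoppedPotential
    rw [if_pos ⟨rfl, trivial⟩]
    refine ENNReal.ofReal_le_ofReal ?_
    unfold pairPotential
    simp only [attackState, sub_self, mul_zero, Real.exp_zero, Finset.sum_const, nsmul_eq_mul,
      mul_one, pow_zero, one_mul]
    have : (N₀ᶜ.card : ℝ) ≤ n := by exact_mod_cast by simpa using N₀ᶜ.card_le_univ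
    rw [pow_two]
    exact mul_le_mul this this (Nat.cast_nonneg _) (Nat.cast_nonneg _)
  | succ i ih =>
    rw [attackRun, mean_bind]
    refine (mean_mono_of_support _ fun t ht => mean_attackStep_stoppedPotential_le qr hD hε hN hs0
      hs5 (length_of_mem_support qr i ht).1).trans ?_
    rw [mean_mul_left, pow_succ' (Real.exp _), mul_assoc, ENNReal.ofReal_mul (Real.exp_pos _).le]
    exact mul_le_mul_right ih _

open Classical in
/-- Concentration fails with small probability. -/
theorem mean_attackRun_not_concentrated_le (qr : QueryResponder S δ r) (hD : Determines S N₀ ε)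
    (hε : 0 ≤ ε) (hN : 1000 * N₀.card ≤ n) (hn : 1 ≤ n) {β : ℝ}
    (hβ : ∀ j, 1 ≤ j → j ≤ r → margin n r j ≤ j →
      Real.exp (25 * tilt n r j ^ 2 / 204 + ε * Real.exp 5) ^ j * n ^ 2 ≤ β * barrier n r j)
    (i : ℕ) (hi : i ≤ r) :
    mean (attackRun qr i) (fun t => if Concentrated N₀ r t then 0 else 1) ≤
      i * ENNReal.ofReal β := by
  have hn' : (0 : ℝ) < n := by exact_mod_cast hn
  induction i with
  | zero =>
    rw [attackRun, mean_pure, if_pos (show Concentrated N₀ r [] from trivial)]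
    exact zero_le
  | succ i ih =>
    -- Failure in round `i + 1` means that the potential has reached the barrier.
    have hnew : mean (attackRun qr (i + 1)) (fun t =>
        if t.length = i + 1 ∧ Concentrated N₀ r t.tail ∧ ¬ Concentrated N₀ r t then 1 else 0) ≤
        ENNReal.ofReal β := by
      by_cases hle : margin n r (i + 1) ≤ (i + 1 : ℕ)
      · have hb : 0 < barrier n r (i + 1) := by unfold barrier; positivity
        have hi0 : (0 : ℝ) < (i + 1 : ℕ) := by positivity
        have ht5 : tilt n r (i + 1) ≤ 5 := by
          unfold tilt
          rw [div_le_iff₀ hi0]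
          linarith
        refine (mean_mono_of_support _ (ψ := fun t => ENNReal.ofReal (barrier n r (i + 1))⁻¹ *
          stoppedPotential N₀ r (tilt n r (i + 1)) (i + 1) t) fun t _ => ?_).trans ?_
        · split_ifs with h
          · unfold stoppedPotential
            rw [if_pos ⟨h.1, h.2.1⟩, ← ENNReal.ofReal_mul (by positivity), ENNReal.one_le_ofReal,
              inv_mul_eq_div, one_le_div hb]
            by_contra hlt
            rw [not_le] at hlt
            rcases t with _ | ⟨a, t⟩
            · simp at h
            · have hlen : t.length + 1 = i + 1 := h.1
              refine h.2.2 ⟨h.2.1, fun _ => ?_⟩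
              rw [hlen]
              exact hlt
          · exact zero_le
        · rw [mean_mul_left]
          refine (mul_le_mul_right (mean_attackRun_stoppedPotential_le qr hD hε hN (tilt_nonneg _)
            ht5 (i + 1)) _).trans ?_
          rw [← ENNReal.ofReal_mul (by positivity)]
          refine ENNReal.ofReal_le_ofReal ?_
          rw [inv_mul_le_iff₀ hb, mul_comm (barrier n r (i + 1))]
          exact hβ (i + 1) (by omega) hi hle
      · refine (mean_mono_of_support _ (ψ := fun _ => 0) fun t _ => ?_).trans
          (by rw [mean_const]; exact zero_le)
        rw [if_neg]
        rintro ⟨h1, h2, h3⟩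
        rcases t with _ | ⟨a, t⟩
        · simp at h1
        · have hlen : t.length + 1 = i + 1 := h1
          refine h3 ⟨h2, fun h => ?_⟩
          rw [hlen] at h
          exact absurd h hle
    have hstep : mean (attackRun qr (i + 1)) (fun t => if Concentrated N₀ r t then 0 else 1) ≤
        mean (attackRun qr i) (fun t => if Concentrated N₀ r t then 0 else 1) +
        mean (attackRun qr (i + 1)) (fun t =>
          if t.length = i + 1 ∧ Concentrated N₀ r t.tail ∧ ¬ Concentrated N₀ r t then 1 else 0) := by
      rw [attackRun, mean_bind, mean_bind, ← mean_add]
      refine mean_mono_of_support _ fun t ht => ?_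
      by_cases hc : CorrectMapExists S δ (maskOf r t)
      · rw [← mean_const (attackStep qr t) (if Concentrated N₀ r t then 0 else 1), ← mean_add]
        refine mean_mono_of_support _ fun t' ht' => ?_
        obtain ⟨a, rfl⟩ := exists_cons_of_mem_support qr hc ht'
        have hlen := (length_of_mem_support qr i ht).2 hc
        by_cases h1 : Concentrated N₀ r (a :: t)
        · rw [if_pos h1]; exact zero_le
        · by_cases h2 : Concentrated N₀ r t
          · have h3 : (a :: t).length = i + 1 ∧ Concentrated N₀ r (a :: t).tail ∧
                ¬ Concentrated N₀ r (a :: t) := ⟨by rw [List.length_cons, hlen], h2, h1⟩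
            rw [if_neg h1, if_pos h3]
            exact le_add_self
          · rw [if_neg h1, if_neg h2]
            exact le_self_add
      · rw [mean_attackStep_of_not qr hc]
        exact le_self_add
    refine hstep.trans ?_
    rw [Nat.cast_add, Nat.cast_one, add_mul, one_mul]
    exact add_le_add (ih (by omega)) hnew

/-! ### The attack exits -/

open Classical in
/-- The total advantage that the keys of `N₀` may still gain. -/
def slack (N₀ : Finset (Fin n)) (r : ℕ) (t : Transcript n) : ℝ≥0∞ :=
  if Concentrated N₀ r t then
    ENNReal.ofReal (N₀.card * (3 * margin n r r + 2) - ∑ x ∈ N₀, advantage N₀ r x t) else 0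

open Classical in
/-- A round with a correct map consumes a constant amount of slack on average. -/
theorem mean_attackStep_slack_le (qr : QueryResponder S δ r) (hD : Determines S N₀ ε)
    (hN : 1000 * N₀.card ≤ n) (hn : 10 ^ 7 ≤ n) (hδ : 0 ≤ δ) (hδ1 : δ ≤ 1 / 1000)
    (hε : ε ≤ 1 / 1000) (hεN : N₀.card * ε ≤ 1 / 100) {t : Transcript n} (hlen : t.length < r) :
    mean (attackStep qr t) (slack N₀ r) + ENNReal.ofReal (2 / 5) *
      (if Concentrated N₀ r t ∧ CorrectMapExists S δ (maskOf r t) then 1 else 0) ≤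
      slack N₀ r t := by
  by_cases hc : CorrectMapExists S δ (maskOf r t)
  · by_cases hcon : Concentrated N₀ r t
    · rw [if_pos ⟨hcon, hc⟩, mul_one]
      have hadv := fun x => hcon.advantage_le hN (by omega) (by omega) hlen.le x
      have hg : ∀ a, 0 ≤ N₀.card * (3 * margin n r r + 2) - ∑ x ∈ N₀, advantage N₀ r x (a :: t) := by
        intro a
        rw [sub_nonneg, ← nsmul_eq_mul]
        refine Finset.sum_le_card_nsmul _ _ _ fun x _ => ?_
        have h1 := hadv x
        have h2 := advantage_cons_le (r := r) N₀ x a t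
        linarith
      have hφ : ∀ a, slack N₀ r (a :: t) ≤ ENNReal.ofReal
          (N₀.card * (3 * margin n r r + 2) - ∑ x ∈ N₀, advantage N₀ r x (a :: t)) := by
        intro a
        unfold slack
        split_ifs <;> simp
      have hM := hcon.maskOf_subset hN
      have hdrift := hD.le_sum_advantage hM hN hn hδ hδ1 hε hεN (qr.correct t hc)
      refine (add_le_add_left (mean_attackStep_le qr hc hg hφ) _).trans ?_
      set π := qr.select t
      set M := maskOf r t with hMdef
      set W := (N₀.card : ℝ) * (3 * margin n r r + 2) with hW
      set Ψ := ∑ x ∈ N₀, advantage N₀ r x t with hΨ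
      have e1 : ∀ U, ∑ x ∈ N₀, advantage N₀ r x ((U, true) :: t) =
          Ψ + ∑ x ∈ N₀ \ M, (ind x U - outsideRate N₀ U) := by
        intro U
        simp only [advantage, Finset.sum_add_distrib, Bool.toNat_true, Nat.cast_one, one_mul]
        congr 1
        rw [Finset.sdiff_eq_filter, Finset.sum_filter]
        refine Finset.sum_congr rfl fun x _ => ?_
        rw [← hMdef]
        split_ifs <;> simp_all
      have e2 : ∀ U, ∑ x ∈ N₀, advantage N₀ r x ((U, false) :: t) = Ψ := by
        intro U
        simp [advantage, hΨ]
      have e3 : ∑ U, sampleWeight U *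
          (π (S (M ∪ U)) * (W - ∑ x ∈ N₀, advantage N₀ r x ((U, true) :: t)) +
            (1 - π (S (M ∪ U))) * (W - ∑ x ∈ N₀, advantage N₀ r x ((U, false) :: t))) =
          W - Ψ - ∑ U, sampleWeight U *
            (π (S (M ∪ U)) * ∑ x ∈ N₀ \ M, (ind x U - outsideRate N₀ U)) := by
        have : W - Ψ = ∑ U : Finset (Fin n), sampleWeight U * (W - Ψ) := by
          rw [← Finset.sum_mul, sum_sampleWeight, one_mul]
        rw [this, ← Finset.sum_sub_distrib]
        refine Finset.sum_congr rfl fun U _ => ?_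
        rw [e1, e2]
        ring
      have hnonneg : 0 ≤ ∑ U, sampleWeight U *
          (π (S (M ∪ U)) * (W - ∑ x ∈ N₀, advantage N₀ r x ((U, true) :: t)) +
            (1 - π (S (M ∪ U))) * (W - ∑ x ∈ N₀, advantage N₀ r x ((U, false) :: t))) := by
        refine Finset.sum_nonneg fun U _ => mul_nonneg (sampleWeight_nonneg U) ?_
        have hp := (π (S (M ∪ U))).2
        exact add_nonneg (mul_nonneg hp.1 (hg _)) (mul_nonneg (by linarith [hp.2]) (hg _))
      rw [← ENNReal.ofReal_add hnonneg (by norm_num)]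
      unfold slack
      rw [if_pos hcon]
      refine ENNReal.ofReal_le_ofReal ?_
      rw [e3]
      linarith
    · rw [if_neg fun h => hcon h.1, mul_zero, add_zero]
      refine (mean_mono_of_support _ (ψ := fun _ => 0) fun t' ht' => ?_).trans
        (by rw [mean_const]; exact zero_le)
      obtain ⟨a, rfl⟩ := exists_cons_of_mem_support qr hc ht'
      unfold slack
      rw [if_neg fun h => hcon h.1]
  · rw [if_neg fun h => hc h.2, mul_zero, add_zero, mean_attackStep_of_not qr hc]

open Classical in
/-- The probability that the attack is still running, and the scores are concentrated, does not
increase. -/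
theorem mean_attackRun_running_succ_le (qr : QueryResponder S δ r) (i : ℕ) :
    mean (attackRun qr (i + 1))
      (fun t => if Concentrated N₀ r t ∧ CorrectMapExists S δ (maskOf r t) then 1 else 0) ≤
    mean (attackRun qr i)
      (fun t => if Concentrated N₀ r t ∧ CorrectMapExists S δ (maskOf r t) then 1 else 0) := by
  rw [attackRun, mean_bind]
  refine mean_mono_of_support _ fun t _ => ?_
  by_cases hc : CorrectMapExists S δ (maskOf r t)
  · rw [← mean_const (attackStep qr t) (if Concentrated N₀ r t ∧
      CorrectMapExists S δ (maskOf r t) then 1 else 0)]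
    refine mean_mono_of_support _ fun t' ht' => ?_
    obtain ⟨a, rfl⟩ := exists_cons_of_mem_support qr hc ht'
    by_cases h : Concentrated N₀ r t
    · refine le_trans ?_ (if_pos ⟨h, hc⟩).ge
      split_ifs <;> simp
    · rw [if_neg fun h' => h h'.1.1]
      exact zero_le
  · rw [mean_attackStep_of_not qr hc]

open Classical in
theorem mean_attackRun_slack_le (qr : QueryResponder S δ r) (hD : Determines S N₀ ε)
    (hN : 1000 * N₀.card ≤ n) (hn : 10 ^ 7 ≤ n) (hδ : 0 ≤ δ) (hδ1 : δ ≤ 1 / 1000)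
    (hε : ε ≤ 1 / 1000) (hεN : N₀.card * ε ≤ 1 / 100) (i : ℕ) (hi : i ≤ r) :
    mean (attackRun qr i) (slack N₀ r) + i * (ENNReal.ofReal (2 / 5) * mean (attackRun qr i)
      (fun t => if Concentrated N₀ r t ∧ CorrectMapExists S δ (maskOf r t) then 1 else 0)) ≤
      ENNReal.ofReal (N₀.card * (3 * margin n r r + 2)) := by
  induction i with
  | zero =>
    rw [attackRun, mean_pure]
    unfold slack
    rw [if_pos (show Concentrated N₀ r [] from trivial)]
    simp [advantage]
  | succ i ih =>
    refine le_trans ?_ (ih (by omega))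
    have h1 := mul_le_mul_right (mean_attackRun_running_succ_le (N₀ := N₀) qr i)
      (ENNReal.ofReal (2 / 5))
    refine (add_le_add_right (mul_le_mul_right h1 _) _).trans ?_
    rw [Nat.cast_add, Nat.cast_one, add_mul, one_mul, add_comm ((i : ℝ≥0∞) * _), ← add_assoc]
    refine add_le_add_left ?_ _
    rw [← mean_mul_left, attackRun, mean_bind, ← mean_add]
    refine mean_mono_of_support _ fun t ht => ?_
    exact mean_attackStep_slack_le qr hD hN hn hδ hδ1 hε hεN
      (lt_of_le_of_lt (length_of_mem_support qr i ht).1 hi)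

/-- The attack succeeds if few keys determine the sketch. -/
theorem Determines.le_successProb (qr : QueryResponder S δ r) (hD : Determines S N₀ ε)
    (hε0 : 0 ≤ ε) (hN : 1000 * N₀.card ≤ n) (hn : 10 ^ 7 ≤ n) (hr : 1 ≤ r) (hδ : 0 ≤ δ)
    (hδ1 : δ ≤ 1 / 1000) (hε : ε ≤ 1 / 1000) (hεN : N₀.card * ε ≤ 1 / 100) {α β : ℝ}
    (hα : (N₀.card : ℝ) < α * n)
    (hβ : ∀ j, 1 ≤ j → j ≤ r → margin n r j ≤ j →
      Real.exp (25 * tilt n r j ^ 2 / 204 + ε * Real.exp 5) ^ j * n ^ 2 ≤ β * barrier n r j)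
    (hβr : r * β ≤ 1 / 200)
    (hlong : N₀.card * (3 * margin n r r + 2) ≤ 1 / 200 * (2 / 5 * r)) :
    ENNReal.ofReal 0.99 ≤ successProb α qr := by
  classical
  have hr0 : (0 : ℝ) < r := by exact_mod_cast hr
  have h1 : mean (attackRun qr r) (fun t => if Concentrated N₀ r t then 0 else 1) ≤
      ENNReal.ofReal (1 / 200) := by
    refine (mean_attackRun_not_concentrated_le qr hD hε0 hN (by omega) hβ r le_rfl).trans ?_
    rw [← ENNReal.ofReal_natCast, ← ENNReal.ofReal_mul hr0.le]
    exact ENNReal.ofReal_le_ofReal hβr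
  have h2 : mean (attackRun qr r)
      (fun t => if Concentrated N₀ r t ∧ CorrectMapExists S δ (maskOf r t) then 1 else 0) ≤
      ENNReal.ofReal (1 / 200) := by
    have := le_add_self.trans
      (mean_attackRun_slack_le qr hD hN hn hδ hδ1 hε hεN r le_rfl)
    have h3 := this.trans (ENNReal.ofReal_le_ofReal hlong)
    rw [← mul_assoc, ← ENNReal.ofReal_natCast, ← ENNReal.ofReal_mul hr0.le, mul_comm (r : ℝ),
      ENNReal.ofReal_mul (by norm_num : (0 : ℝ) ≤ 1 / 200), mul_comm (ENNReal.ofReal (1 / 200))]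
      at h3
    refine (ENNReal.mul_le_mul_iff_right ?_ ENNReal.ofReal_ne_top).1 h3
    rw [Ne, ENNReal.ofReal_eq_zero, not_le]
    positivity
  have h3 : (1 : ℝ≥0∞) ≤ successProb α qr + (ENNReal.ofReal (1 / 200) + ENNReal.ofReal (1 / 200)) := by
    refine le_trans ?_ (add_le_add_right (add_le_add h1 h2) _)
    have e : successProb α qr = mean (attackRun qr r) fun t =>
        if ((maskOf r t).card : ℝ) < α * n ∧ ¬ CorrectMapExists S δ (maskOf r t) then 1 else 0 := by
      unfold successProb mean
      rw [PMF.toOuterMeasure_apply]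
      refine tsum_congr fun t => ?_
      simp [Set.indicator_apply]
    rw [e, ← mean_add, ← mean_add]
    refine (mean_const (attackRun qr r) 1).ge.trans ?_
    refine mean_mono_of_support _ fun t _ => ?_
    by_cases hc : Concentrated N₀ r t
    · by_cases hm : CorrectMapExists S δ (maskOf r t)
      · simp [hc, hm]
      · have hM : ((maskOf r t).card : ℝ) ≤ N₀.card := by
          exact_mod_cast Finset.card_le_card (hc.maskOf_subset hN)
        simp [hc, hm, hM.trans_lt hα]
    · simp [hc]
  rw [← ENNReal.ofReal_add (by norm_num) (by norm_num)] at h3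
  have h4 : ENNReal.ofReal 0.99 + ENNReal.ofReal (1 / 200 + 1 / 200) = 1 := by
    rw [← ENNReal.ofReal_add (by norm_num) (by norm_num)]
    norm_num
  rw [← h4] at h3
  exact (ENNReal.add_le_add_iff_right ENNReal.ofReal_ne_top).1 h3

end AttackProbability

/-! ### Few keys determine each sketch -/

section Sketches

variable {n k : ℕ} {Sk : Type}

theorem binExp_disjoint (q : ℝ) (B : Finset (Fin n)) :
    binExp q (fun U => if Disjoint U B then 1 else 0) = (1 - q) ^ B.card := by
  classical
  induction B using Finset.induction_on with
  | empty => simp [binExp_const]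
  | insert x B hx ih =>
    have e : (fun U => if Disjoint U (insert x B) then (1 : ℝ) else 0) =
        fun U => (if Disjoint U B then 1 else 0) - (if Disjoint U B then 1 else 0) * ind x U := by
      funext U
      unfold ind
      by_cases h1 : x ∈ U <;> by_cases h2 : Disjoint U B <;>
        simp [h1, h2, Finset.disjoint_insert_right]
    have hi : Ignores (fun U => if Disjoint U B then (1 : ℝ) else 0) x := by
      intro U
      simp only [Finset.disjoint_insert_left, hx, not_false_eq_true, true_and]
    rw [e, binExp_sub, binExp_mul_ind hi, ih, Finset.card_insert_of_notMem hx, pow_succ]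
    ring

/-- It suffices that misleading sets miss one of `k` blocks of at least `ℓ` keys. -/
theorem determines_of_blocks {S : Finset (Fin n) → Sk} {N₀ : Finset (Fin n)} {ℓ : ℕ}
    (B : Fin k → Finset (Fin n))
    (h : ∀ U, Misleading S N₀ U → ∃ i, ℓ ≤ (B i).card ∧ Disjoint U (B i)) :
    Determines S N₀ (k * (19 / 20) ^ ℓ) := by
  classical
  intro q h0 h1
  have hq0 : 0 ≤ q := by linarith
  have hq1 : q ≤ 1 := by linarith
  have hpt : ∀ U, (if Misleading S N₀ U then (1 : ℝ) else 0) ≤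
      ∑ i, if ℓ ≤ (B i).card then (if Disjoint U (B i) then 1 else 0) else 0 := by
    intro U
    have hnn : ∀ i ∈ Finset.univ, (0 : ℝ) ≤
        if ℓ ≤ (B i).card then (if Disjoint U (B i) then 1 else 0) else 0 := by
      intro i _
      split_ifs <;> norm_num
    split_ifs with hU
    · obtain ⟨i, hi, hd⟩ := h U hU
      refine le_trans ?_ (Finset.single_le_sum hnn (Finset.mem_univ i))
      rw [if_pos hi, if_pos hd]
    · exact Finset.sum_nonneg hnn
  refine (binExp_mono hq0 hq1 hpt).trans ?_
  rw [binExp_sum]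
  have : ∀ i ∈ Finset.univ, binExp q (fun U =>
      if ℓ ≤ (B i).card then (if Disjoint U (B i) then (1 : ℝ) else 0) else 0) ≤ (19 / 20) ^ ℓ := by
    intro i _
    split_ifs with hi
    · rw [binExp_disjoint]
      calc (1 - q) ^ (B i).card ≤ (1 - q) ^ ℓ := pow_le_pow_of_le_one (by linarith) (by linarith) hi
        _ ≤ _ := pow_le_pow_left₀ (by linarith) (by linarith) ℓ
    · rw [binExp_const]; positivity
  refine (Finset.sum_le_card_nsmul _ _ _ this).trans ?_
  simp

/-- The `ℓ` keys of `P` with the smallest values, or all of them if there are fewer. -/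
theorem exists_bottom (P : Finset (Fin n)) (h : Fin n → ℝ) (ℓ : ℕ) :
    ∃ B ⊆ P, B.card ≤ ℓ ∧ (ℓ ≤ B.card ∨ B = P) ∧ ∀ x ∈ B, ∀ y ∈ P, y ∉ B → h x ≤ h y := by
  induction ℓ with
  | zero => exact ⟨∅, by simp, by simp, Or.inl (by simp), by simp⟩
  | succ ℓ ih =>
    obtain ⟨B, hBP, hc, hor, hle⟩ := ih
    by_cases hB : B = P
    · exact ⟨B, hBP, by omega, Or.inr hB, hle⟩
    · have hne : (P \ B).Nonempty := by
        rw [Finset.sdiff_nonempty]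
        exact fun h => hB (hBP.antisymm h)
      obtain ⟨z, hz, hmin⟩ := Finset.exists_min_image (P \ B) h hne
      rw [Finset.mem_sdiff] at hz
      have hcard := Finset.card_insert_of_notMem hz.2
      have hl : ℓ ≤ B.card := hor.resolve_right hB
      refine ⟨insert z B, Finset.insert_subset hz.1 hBP, by omega, Or.inl (by omega), ?_⟩
      intro x hx y hy hyB
      rw [Finset.mem_insert, not_or] at hyB
      rcases Finset.mem_insert.1 hx with rfl | hx
      · exact hmin y (Finset.mem_sdiff.2 ⟨hy, hyB.2⟩)
      · exact hle x hx y hy hyB.2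

theorem inf_eq_inf_of_subset {W W' : Finset (Fin n)} {h : Fin n → ℝ} (hW : W' ⊆ W)
    (hle : ∀ y ∈ W, y ∉ W' → ∃ x ∈ W', h x ≤ h y) :
    (W.inf fun x => (h x : WithTop ℝ)) = W'.inf fun x => (h x : WithTop ℝ) := by
  refine le_antisymm (Finset.inf_mono hW) (Finset.le_inf fun y hy => ?_)
  by_cases hy' : y ∈ W'
  · exact Finset.inf_le hy'
  · obtain ⟨x, hx, hxy⟩ := hle y hy hy'
    exact (Finset.inf_le hx).trans (by exact_mod_cast hxy)

theorem card_biUnion_le_mul {ℓ : ℕ} {B : Fin k → Finset (Fin n)} (hB : ∀ i, (B i).card ≤ ℓ) :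
    (Finset.univ.biUnion B).card ≤ k * ℓ := by
  refine Finset.card_biUnion_le.trans ((Finset.sum_le_card_nsmul _ _ ℓ fun i _ => hB i).trans ?_)
  simp

theorem exists_determines_kMins (h : Fin k → Fin n → ℝ) (ℓ : ℕ) :
    ∃ N₀ : Finset (Fin n), N₀.card ≤ k * ℓ ∧ Determines (kMins h) N₀ (k * (19 / 20) ^ ℓ) := by
  choose B _ hc hor hle using fun i => exists_bottom Finset.univ (h i) ℓ
  refine ⟨Finset.univ.biUnion B, card_biUnion_le_mul hc, determines_of_blocks B ?_⟩
  rintro U ⟨M, -, hne⟩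
  by_contra hcon
  push Not at hcon
  refine hne ?_
  funext i
  refine inf_eq_inf_of_subset
    (Finset.union_subset_union_right Finset.inter_subset_left) fun y hy hy' => ?_
  have hyU : y ∈ U := by simp only [Finset.mem_union, Finset.mem_inter] at hy hy'; tauto
  have hyN : y ∉ Finset.univ.biUnion B := by
    simp only [Finset.mem_union, Finset.mem_inter] at hy hy'; tauto
  have hyB : y ∉ B i := fun h => hyN (Finset.mem_biUnion.2 ⟨i, Finset.mem_univ _, h⟩)
  have hl : ℓ ≤ (B i).card := (hor i).resolve_right fun h => hyB (h ▸ Finset.mem_univ _)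
  obtain ⟨x, hxU, hxB⟩ := Finset.not_disjoint_iff.1 (hcon i hl)
  refine ⟨x, ?_, hle i x hxB y (Finset.mem_univ _) hyB⟩
  exact Finset.mem_union_right _ (Finset.mem_inter.2
    ⟨hxU, Finset.mem_biUnion.2 ⟨i, Finset.mem_univ _, hxB⟩⟩)

theorem exists_determines_kPartition (ρ : (Fin n → Fin k) × (Fin n → ℝ)) (ℓ : ℕ) :
    ∃ N₀ : Finset (Fin n), N₀.card ≤ k * ℓ ∧
      Determines (kPartition ρ) N₀ (k * (19 / 20) ^ ℓ) := by
  choose B hP hc hor hle using fun i =>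
    exists_bottom (Finset.univ.filter fun x => ρ.1 x = i) ρ.2 ℓ
  refine ⟨Finset.univ.biUnion B, card_biUnion_le_mul hc, determines_of_blocks B ?_⟩
  rintro U ⟨M, -, hne⟩
  by_contra hcon
  push Not at hcon
  refine hne ?_
  funext i
  refine inf_eq_inf_of_subset (Finset.filter_subset_filter _
    (Finset.union_subset_union_right Finset.inter_subset_left)) fun y hy hy' => ?_
  have hyi : ρ.1 y = i := (Finset.mem_filter.1 hy).2
  have hyP : y ∈ Finset.univ.filter fun x => ρ.1 x = i := by simp [hyi]
  have hyU : y ∈ U := by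
    simp only [Finset.mem_filter, Finset.mem_union, Finset.mem_inter] at hy hy'; tauto
  have hyN : y ∉ Finset.univ.biUnion B := by
    simp only [Finset.mem_filter, Finset.mem_union, Finset.mem_inter] at hy hy'; tauto
  have hyB : y ∉ B i := fun h => hyN (Finset.mem_biUnion.2 ⟨i, Finset.mem_univ _, h⟩)
  have hl : ℓ ≤ (B i).card := (hor i).resolve_right fun h => hyB (h ▸ hyP)
  obtain ⟨x, hxU, hxB⟩ := Finset.not_disjoint_iff.1 (hcon i hl)
  refine ⟨x, Finset.mem_filter.2 ⟨?_, (Finset.mem_filter.1 (hP i hxB)).2⟩, hle i x hxB y hyP hyB⟩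
  exact Finset.mem_union_right _ (Finset.mem_inter.2
    ⟨hxU, Finset.mem_biUnion.2 ⟨i, Finset.mem_univ _, hxB⟩⟩)

theorem sort_add_of_le {s t : Multiset ℝ} (h : ∀ a ∈ s, ∀ b ∈ t, a ≤ b) :
    (s + t).sort (· ≤ ·) = s.sort (· ≤ ·) ++ t.sort (· ≤ ·) := by
  refine List.Perm.eq_of_pairwise' (r := (· ≤ ·)) (Multiset.pairwise_sort _ _) ?_ ?_
  · rw [List.pairwise_append]
    refine ⟨Multiset.pairwise_sort _ _, Multiset.pairwise_sort _ _, fun a ha b hb => ?_⟩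
    exact h a (by simpa using ha) b (by simpa using hb)
  · rw [← Multiset.coe_eq_coe, ← Multiset.coe_add]
    simp only [Multiset.sort_eq]

theorem bottomK_eq_of_subset {h : Fin n → ℝ} {W W' : Finset (Fin n)} (hW : W' ⊆ W)
    (hk : k ≤ W'.card) (hle : ∀ x ∈ W', ∀ y ∈ W, y ∉ W' → h x ≤ h y) :
    bottomK k h W = bottomK k h W' := by
  have e : W.val.map h = W'.val.map h + (W \ W').val.map h := by
    rw [← Multiset.map_add]
    congr 1
    have := Finset.disjUnion_val W' (W \ W') Finset.disjoint_sdiff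
    rw [← this, Finset.disjUnion_eq_union, Finset.union_sdiff_of_subset hW]
  unfold bottomK
  rw [e, sort_add_of_le, List.take_append_of_le_length]
  · rw [Multiset.length_sort, Multiset.card_map]
    exact hk
  · intro a ha b hb
    obtain ⟨x, hx, rfl⟩ := Multiset.mem_map.1 ha
    obtain ⟨y, hy, rfl⟩ := Multiset.mem_map.1 hb
    have hy' := Finset.mem_sdiff.1 hy
    exact hle x hx y hy'.1 hy'.2

theorem exists_determines_bottomK (h : Fin n → ℝ) (ℓ : ℕ) :
    ∃ N₀ : Finset (Fin n), N₀.card ≤ k * ℓ ∧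
      Determines (bottomK k h) N₀ (k * (19 / 20) ^ ℓ) := by
  obtain ⟨B, -, hc, hor, hle⟩ := exists_bottom Finset.univ h (k * ℓ)
  refine ⟨B, hc, ?_⟩
  by_cases hB : B = Finset.univ
  · refine determines_of_blocks (fun _ => ∅) ?_
    rintro U ⟨M, -, hne⟩
    rw [hB, Finset.inter_univ] at hne
    exact absurd rfl hne
  · -- Cut `B` into `k` blocks of `ℓ` keys. A set that meets each of them has `k` keys in `B`.
    have hcard : B.card = k * ℓ := le_antisymm hc (hor.resolve_right hB)
    let e : Fin k × Fin ℓ ≃ B := finProdFinEquiv.trans (B.equivFinOfCardEq hcard).symm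
    let blk : Fin k → Finset (Fin n) := fun i => Finset.univ.image fun j : Fin ℓ => (e (i, j) : Fin n)
    have hblk : ∀ i, (blk i).card = ℓ := by
      intro i
      rw [Finset.card_image_of_injective, Finset.card_univ, Fintype.card_fin]
      intro j j' hj
      have := e.injective (Subtype.ext hj)
      exact (Prod.ext_iff.1 this).2
    refine determines_of_blocks blk ?_
    rintro U ⟨M, hM, hne⟩
    by_contra hcon
    push Not at hcon
    refine hne ?_
    have hpick : ∀ i, ∃ j, (e (i, j) : Fin n) ∈ U := by
      intro i
      obtain ⟨x, hxU, hx⟩ := Finset.not_disjoint_iff.1 (hcon i (hblk i).ge)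
      obtain ⟨j, -, rfl⟩ := Finset.mem_image.1 hx
      exact ⟨j, hxU⟩
    choose j hj using hpick
    have hk : k ≤ (U ∩ B).card := by
      have h1 : (Finset.univ.image fun i => (e (i, j i) : Fin n)) ⊆ U ∩ B := by
        intro x hx
        obtain ⟨i, -, rfl⟩ := Finset.mem_image.1 hx
        exact Finset.mem_inter.2 ⟨hj i, (e (i, j i)).2⟩
      have h2 := Finset.card_le_card h1
      rw [Finset.card_image_of_injective, Finset.card_univ, Fintype.card_fin] at h2
      · exact h2
      · intro i i' hi
        have := e.injective (Subtype.ext hi)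
        exact (Prod.ext_iff.1 this).1
    refine bottomK_eq_of_subset (Finset.union_subset_union_right Finset.inter_subset_left)
      (hk.trans (Finset.card_le_card Finset.subset_union_right)) fun x hx y hy hy' => ?_
    have hxB : x ∈ B := by
      rcases Finset.mem_union.1 hx with h | h
      · exact hM h
      · exact (Finset.mem_inter.1 h).2
    have hyB : y ∉ B := by
      simp only [Finset.mem_union, Finset.mem_inter] at hy hy'
      tauto
    exact hle x hxB y (Finset.mem_univ _) hyB

/-! ### The laws of the randomness -/

instance isProbabilityMeasure_kMinsLaw (k n : ℕ) (ν : Measure ℝ) [IsProbabilityMeasure ν] :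
    IsProbabilityMeasure (kMinsLaw k n ν) := by
  unfold kMinsLaw; infer_instance

instance isProbabilityMeasure_bottomKLaw (n : ℕ) (ν : Measure ℝ) [IsProbabilityMeasure ν] :
    IsProbabilityMeasure (bottomKLaw n ν) := by
  unfold bottomKLaw; infer_instance

theorem isProbabilityMeasure_kPartitionLaw (hk : 1 ≤ k) (n : ℕ) (ν : Measure ℝ)
    [IsProbabilityMeasure ν] : IsProbabilityMeasure (kPartitionLaw k n ν) := by
  have : Nonempty (Fin k) := ⟨⟨0, hk⟩⟩
  have := ProbabilityTheory.isProbabilityMeasure_uniformOn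
    (Set.finite_univ : (Set.univ : Set (Fin n → Fin k)).Finite) Set.univ_nonempty
  unfold kPartitionLaw
  infer_instance

/-- A success probability that is guaranteed for each value of the randomness of the sketch. -/
theorem attackSucceeds_of_forall {R : Type} [MeasurableSpace R] {law : Measure R}
    [IsProbabilityMeasure law] {sketch : R → Finset (Fin n) → Sk} {α δ : ℝ} {r : ℕ}
    (h : ∀ ρ (qr : QueryResponder (sketch ρ) δ r), ENNReal.ofReal 0.99 ≤ successProb α qr) :
    AttackSucceeds law sketch α δ r := by
  intro Ω _ P _ qr
  calc ENNReal.ofReal 0.99 = ∫⁻ _, ENNReal.ofReal 0.99 ∂(law.prod P) := by simp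
    _ ≤ _ := lintegral_mono fun z => h z.1 (qr z.1 z.2)

end Sketches

/-! ### The choice of the constants -/

section Constants

theorem ten_pow_le_exp {x : ℝ} (hx : 60 ≤ x) : (10 : ℝ) ^ 15 ≤ Real.exp x := by
  have h1 : (2 : ℝ) ≤ Real.exp 1 := by
    have := Real.add_one_le_exp (1 : ℝ)
    linarith
  calc (10 : ℝ) ^ 15 ≤ 2 ^ 60 := by norm_num
    _ ≤ Real.exp 1 ^ 60 := pow_le_pow_left₀ (by norm_num) h1 60
    _ = Real.exp 60 := by rw [← Real.exp_nat_mul]; norm_num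
    _ ≤ Real.exp x := Real.exp_le_exp.2 hx

/-- The attack is long enough for its total advantage to exceed what the unmasked keys can hold:
`r` dominates `k ^ 2 * log (k r) ^ 2 * log (n r)`, even if `r` is exponential in `n`. -/
theorem length_bound {k n r a : ℝ} (hk : 1 ≤ k) (hn : 1 ≤ n) (hka : k ≤ a) (hna : n ≤ a)
    (hr : Real.exp 1000 ≤ r) (hra : Real.exp 2000 * (k ^ 2 * Real.log a ^ 3) ≤ r) :
    10 ^ 10 * (k ^ 2 * (Real.log (k * r) ^ 2 * Real.log (200 * n * r))) ≤ r := by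
  have hr0 : 0 < r := (Real.exp_pos _).trans_le hr
  have ha0 : 0 < a := by linarith
  set x := Real.log r with hx
  set y := Real.log a with hy
  have hx1 : 1000 ≤ x := (Real.le_log_iff_exp_le hr0).2 hr
  have hy0 : 0 ≤ y := Real.log_nonneg (by linarith)
  have hk0 : 0 ≤ Real.log k := Real.log_nonneg hk
  have hky : Real.log k ≤ y := Real.log_le_log (by linarith) hka
  have hny : Real.log n ≤ y := Real.log_le_log (by linarith) hna
  have h200 : Real.log 200 ≤ 1000 := by
    have := Real.log_le_sub_one_of_pos (show (0 : ℝ) < 200 by norm_num)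
    linarith
  have e1 : Real.log (k * r) = Real.log k + x := Real.log_mul (by linarith) hr0.ne'
  have e2 : Real.log (200 * n * r) = Real.log 200 + Real.log n + x := by
    rw [Real.log_mul (by positivity) hr0.ne', Real.log_mul (by norm_num) (by linarith)]
  have h1 : Real.log (k * r) ^ 2 * Real.log (200 * n * r) ≤ (2 * (x + y)) ^ 3 := by
    rw [pow_succ, e1, e2]
    refine mul_le_mul (pow_le_pow_left₀ (by linarith) (by linarith) 2) (by linarith) ?_
      (sq_nonneg _)
    · have := Real.log_nonneg (show (1 : ℝ) ≤ 200 by norm_num)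
      have := Real.log_nonneg hn
      linarith
  have hk2 : 0 ≤ k ^ 2 := by positivity
  have h2 : 10 ^ 10 * (k ^ 2 * (Real.log (k * r) ^ 2 * Real.log (200 * n * r))) ≤
      10 ^ 10 * (k ^ 2 * (2 * (x + y)) ^ 3) := by
    have := mul_le_mul_of_nonneg_left h1 hk2
    linarith
  refine h2.trans ?_
  by_cases hxy : x ≤ 8 * y
  · refine le_trans ?_ hra
    have h3 : (2 * (x + y)) ^ 3 ≤ (18 * y) ^ 3 := pow_le_pow_left₀ (by linarith) (by linarith) 3
    have h4 : (10 : ℝ) ^ 10 * 18 ^ 3 ≤ Real.exp 2000 :=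
      le_trans (by norm_num) (ten_pow_le_exp (by norm_num))
    calc 10 ^ 10 * (k ^ 2 * (2 * (x + y)) ^ 3) ≤ 10 ^ 10 * (k ^ 2 * (18 * y) ^ 3) := by
          have := mul_le_mul_of_nonneg_left h3 hk2
          linarith
      _ = 10 ^ 10 * 18 ^ 3 * (k ^ 2 * y ^ 3) := by ring
      _ ≤ _ := mul_le_mul_of_nonneg_right h4 (by positivity)
  · rw [not_le] at hxy
    have h3 : k ^ 2 ≤ Real.exp (x / 4) := by
      have : k ≤ Real.exp (x / 8) := by
        rw [← Real.log_le_iff_le_exp (by linarith)]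
        linarith
      calc k ^ 2 ≤ Real.exp (x / 8) ^ 2 := pow_le_pow_left₀ (by linarith) this 2
        _ = Real.exp (x / 4) := by rw [← Real.exp_nat_mul]; congr 1; push_cast; ring
    have h4 : (2 * (x + y)) ^ 3 ≤ (9 / 4 * x) ^ 3 :=
      pow_le_pow_left₀ (by linarith) (by linarith) 3
    have h5 : (x / 4) ^ 3 / 6 ≤ Real.exp (x / 4) := by
      have := Real.pow_div_factorial_le_exp (x / 4) (by linarith) 3
      norm_num [Nat.factorial] at this ⊢
      exact this
    have h6 : (10 : ℝ) ^ 10 * 5000 ≤ Real.exp (x / 2) :=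
      le_trans (by norm_num) (ten_pow_le_exp (by linarith))
    have h7 : (9 / 4 * x) ^ 3 ≤ 5000 * Real.exp (x / 4) := by
      have : 0 ≤ x ^ 3 := by positivity
      nlinarith
    calc 10 ^ 10 * (k ^ 2 * (2 * (x + y)) ^ 3)
        ≤ 10 ^ 10 * (Real.exp (x / 4) * (5000 * Real.exp (x / 4))) := by
          refine mul_le_mul_of_nonneg_left ?_ (by norm_num)
          exact mul_le_mul h3 (h4.trans h7) (by positivity) (Real.exp_pos _).le
      _ = (10 ^ 10 * 5000) * Real.exp (x / 2) := by
          have : Real.exp (x / 2) = Real.exp (x / 4) * Real.exp (x / 4) := by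
            rw [← Real.exp_add]; congr 1; ring
          rw [this]; ring
      _ ≤ Real.exp (x / 2) * Real.exp (x / 2) :=
          mul_le_mul_of_nonneg_right h6 (Real.exp_pos _).le
      _ = r := by
          rw [← Real.exp_add, add_halves, hx, Real.exp_log hr0]

theorem tilt_sq_mul {n r j : ℕ} (hL : 0 ≤ Real.log (200 * n * r)) (hj : 1 ≤ j) :
    j * (25 * tilt n r j ^ 2 / 204) = 51 / 50 * Real.log (200 * n * r) ∧
      tilt n r j * margin n r j = 51 / 25 * Real.log (200 * n * r) := by
  have hj0 : (j : ℝ) ≠ 0 := by positivity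
  have h := margin_sq hL j
  constructor
  · have : j * (25 * tilt n r j ^ 2 / 204) = 51 / 25 * margin n r j ^ 2 / j := by
      unfold tilt
      field_simp
      ring
    rw [this, h]
    field_simp
    ring
  · have : tilt n r j * margin n r j = 102 / 25 * margin n r j ^ 2 / j := by
      unfold tilt; ring
    rw [this, h]
    field_simp
    ring

/-- The attack succeeds against a sketch map that is determined by `k ℓ` keys, for each `ℓ`, up to a
failure probability that decays exponentially in `ℓ`. -/
theorem le_successProb_of_exists_determines {k n r : ℕ} {α δ : ℝ} {Sk : Type}
    {S : Finset (Fin n) → Sk} (hk : 1 ≤ k) (hα0 : 0 < α) (hα1 : α ≤ 1) (hδ : 0 ≤ δ)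
    (hδ1 : δ ≤ 1 / 1000 / Real.sqrt k)
    (hn : Real.exp 2000 * (k * Real.log (k * r) / α) ≤ n)
    (hr : Real.exp 2000 * ((k : ℝ) ^ 2 / α ^ 2 * Real.log (k * n / α + 2) ^ 3) ≤ r)
    (hS : ∀ ℓ : ℕ, ∃ N₀ : Finset (Fin n), N₀.card ≤ k * ℓ ∧
      Determines S N₀ (k * (19 / 20) ^ ℓ))
    (qr : QueryResponder S δ r) : ENNReal.ofReal 0.99 ≤ successProb α qr := by
  have hk' : (1 : ℝ) ≤ k := by exact_mod_cast hk
  have hn0 : (0 : ℝ) ≤ n := Nat.cast_nonneg _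
  set a : ℝ := k * n / α + 2 with ha
  have ha2 : 2 ≤ a := by
    have : 0 ≤ (k : ℝ) * n / α := by positivity
    linarith
  have hkα : (k : ℝ) ≤ k / α := by
    rw [le_div_iff₀ hα0]; exact mul_le_of_le_one_right (by linarith) hα1
  have hkα2 : (k : ℝ) ^ 2 ≤ k ^ 2 / α ^ 2 := by
    rw [← div_pow]; exact pow_le_pow_left₀ (by linarith) hkα 2
  have hlog2 : (1 / 2 : ℝ) ≤ Real.log a :=
    le_trans (by linarith [Real.log_two_gt_d9]) (Real.log_le_log (by norm_num) ha2)
  have hlog3 : (1 / 8 : ℝ) ≤ Real.log a ^ 3 := by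
    have := pow_le_pow_left₀ (by norm_num) hlog2 3
    norm_num at this ⊢
    exact this
  have hra : Real.exp 2000 * ((k : ℝ) ^ 2 * Real.log a ^ 3) ≤ r := by
    refine le_trans ?_ hr
    exact mul_le_mul_of_nonneg_left (mul_le_mul_of_nonneg_right hkα2 (by positivity))
      (Real.exp_pos _).le
  have hexp : Real.exp 2000 = Real.exp 1000 * Real.exp 1000 := by
    rw [← Real.exp_add]; norm_num
  have hE8 : 10 ^ 10 ≤ Real.exp 1000 := le_trans (by norm_num) (ten_pow_le_exp (by norm_num))
  have hE : Real.exp 1000 * (k : ℝ) ^ 2 ≤ r := by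
    refine le_trans ?_ hra
    rw [hexp, mul_assoc]
    refine mul_le_mul_of_nonneg_left ?_ (Real.exp_pos _).le
    have : 0 ≤ (k : ℝ) ^ 2 := by positivity
    calc (k : ℝ) ^ 2 = 8 * (k ^ 2 * (1 / 8)) := by ring
      _ ≤ Real.exp 1000 * (k ^ 2 * Real.log a ^ 3) := by
        refine mul_le_mul (by linarith) ?_ (by positivity) (Real.exp_pos _).le
        exact mul_le_mul_of_nonneg_left hlog3 this
  have hr1 : Real.exp 1000 ≤ r := by
    refine le_trans ?_ hE
    exact le_mul_of_one_le_right (Real.exp_pos _).le (one_le_pow₀ hk')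
  have hr10 : (10 : ℝ) ^ 10 ≤ r := hE8.trans hr1
  have hr0 : (0 : ℝ) < r := by linarith
  have hrone : 1 ≤ r := by exact_mod_cast (by linarith : (1 : ℝ) ≤ r)
  have hkr : (k : ℝ) ≤ r :=
    calc (k : ℝ) ≤ k ^ 2 := le_self_pow₀ hk' (by norm_num)
      _ ≤ Real.exp 1000 * k ^ 2 := le_mul_of_one_le_left (by positivity) (by linarith)
      _ ≤ r := hE
  have hx : 1000 ≤ Real.log r := (Real.le_log_iff_exp_le hr0).2 hr1
  set Λ := Real.log (k * r) with hΛ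
  have hΛ1 : 1000 ≤ Λ := hx.trans (Real.log_le_log hr0 (le_mul_of_one_le_left hr0.le hk'))
  have hΛr : Λ ≤ 2 * r := by
    have h1 : Λ = Real.log k + Real.log r := Real.log_mul (by positivity) hr0.ne'
    have h2 := Real.log_le_log (by linarith) hkr
    have h3 := Real.log_le_sub_one_of_pos hr0
    linarith
  have hkΛ : 1000 ≤ (k : ℝ) * Λ := hΛ1.trans (le_mul_of_one_le_left (by linarith) hk')
  have hkΛα : (k : ℝ) * Λ ≤ k * Λ / α := by
    rw [le_div_iff₀ hα0]; exact mul_le_of_le_one_right (by linarith) hα1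
  have hn2 : Real.exp 1000 * (k * Λ) ≤ n := by
    refine le_trans ?_ hn
    refine mul_le_mul (Real.exp_le_exp.2 (by norm_num)) hkΛα (by linarith) (Real.exp_pos _).le
  have hn10 : (10 : ℝ) ^ 10 ≤ n :=
    hE8.trans ((le_mul_of_one_le_right (Real.exp_pos _).le (by linarith)).trans hn2)
  have hn7 : 10 ^ 7 ≤ n := by exact_mod_cast (by linarith : (10 : ℝ) ^ 7 ≤ n)
  have hnpos : (0 : ℝ) < n := by linarith
  -- Blocks of about `40 log (k r)` keys make misleading sets rarer than `1 / r ^ 2`.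
  set ℓ := ⌈40 * Λ⌉₊ with hℓ
  have hℓ1 : 40 * Λ ≤ ℓ := Nat.le_ceil _
  have hℓ2 : (ℓ : ℝ) ≤ 41 * Λ := by
    have := Nat.ceil_lt_add_one (show 0 ≤ 40 * Λ by linarith)
    linarith
  obtain ⟨N₀, hcard, hD⟩ := hS ℓ
  have hm : (N₀.card : ℝ) ≤ 41 * (k * Λ) := by
    have h1 : (N₀.card : ℝ) ≤ k * ℓ := by exact_mod_cast hcard
    have h2 : (k : ℝ) * ℓ ≤ k * (41 * Λ) := mul_le_mul_of_nonneg_left hℓ2 (by linarith)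
    linarith
  set ε : ℝ := k * (19 / 20) ^ ℓ with hε
  have hε0 : 0 ≤ ε := by positivity
  have hεk : ε * (k * r ^ 2) ≤ 1 := by
    have h1 : (19 / 20 : ℝ) ^ ℓ ≤ Real.exp (-(2 * Λ)) := by
      calc (19 / 20 : ℝ) ^ ℓ ≤ Real.exp (-(1 / 20)) ^ ℓ := by
            refine pow_le_pow_left₀ (by norm_num) ?_ ℓ
            have := Real.add_one_le_exp (-(1 / 20) : ℝ)
            linarith
        _ = Real.exp (ℓ * (-(1 / 20))) := by rw [← Real.exp_nat_mul]
        _ ≤ _ := Real.exp_le_exp.2 (by linarith)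
    have h2 : Real.exp (-(2 * Λ)) * (k * r) ^ 2 = 1 := by
      rw [Real.exp_neg, two_mul, Real.exp_add, hΛ, Real.exp_log (by positivity)]
      field_simp
    have h3 : ε * (k * r ^ 2) = (19 / 20) ^ ℓ * (k * r) ^ 2 := by rw [hε]; ring
    rw [h3, ← h2]
    exact mul_le_mul_of_nonneg_right h1 (by positivity)
  have hεr : ε * r ^ 2 ≤ 1 := by
    refine le_trans (mul_le_mul_of_nonneg_left ?_ hε0) hεk
    exact le_mul_of_one_le_left (sq_nonneg _) hk'
  have hεr1 : ε * r ≤ 1 / 10 ^ 10 := by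
    rw [le_div_iff₀ (by norm_num)]
    refine le_trans ?_ hεr
    rw [pow_two, ← mul_assoc]
    exact mul_le_mul_of_nonneg_left hr10 (by positivity)
  have hε1 : ε ≤ 1 / 1000 := by
    have := le_mul_of_one_le_right hε0 (show (1 : ℝ) ≤ r by linarith)
    linarith
  have hεN : N₀.card * ε ≤ 1 / 100 := by
    have h1 : N₀.card * ε ≤ 41 * (k * (2 * r)) * ε :=
      mul_le_mul_of_nonneg_right (hm.trans (by
        have := mul_le_mul_of_nonneg_left hΛr (show (0 : ℝ) ≤ k by linarith)
        linarith)) hε0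
    have h2 : 41 * (k * (2 * r)) * ε * r ≤ 82 := by
      have : 41 * (k * (2 * r)) * ε * r = 82 * (ε * (k * r ^ 2)) := by ring
      rw [this]; linarith
    have h3 : 41 * (k * (2 * r)) * ε * 10 ^ 10 ≤ 41 * (k * (2 * r)) * ε * r :=
      mul_le_mul_of_nonneg_left hr10 (by positivity)
    linarith
  have hδ2 : δ ≤ 1 / 1000 := by
    refine hδ1.trans (div_le_self (by norm_num) ?_)
    rw [Real.one_le_sqrt]
    exact hk'
  set L := Real.log (200 * n * r) with hL
  have hLr : Real.log r ≤ L := by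
    refine Real.log_le_log hr0 ?_
    have : 1 ≤ 200 * (n : ℝ) := by linarith
    exact le_mul_of_one_le_left hr0.le this
  have hL0 : 0 ≤ L := by linarith
  have hexpL : Real.exp L = 200 * n * r := Real.exp_log (by positivity)
  refine hD.le_successProb qr hε0 ?_ hn7 hrone hδ hδ2 hε1 hεN (β := 4 * n * Real.exp (6 - 51 / 50 * L))
    ?_ ?_ ?_ ?_
  · have h1 : 10 ^ 10 * (k * Λ) ≤ Real.exp 1000 * (k * Λ) :=
      mul_le_mul_of_nonneg_right hE8 (by linarith)
    have : (1000 : ℝ) * N₀.card ≤ n := by linarith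
    exact_mod_cast this
  · have h1 : Real.exp 2000 * (k * Λ) ≤ α * n := by
      have := mul_le_mul_of_nonneg_left hn hα0.le
      have e : α * (Real.exp 2000 * (k * Λ / α)) = Real.exp 2000 * (k * Λ) := by
        field_simp
      linarith
    have h2 : (10 : ℝ) ^ 10 ≤ Real.exp 2000 :=
      hE8.trans (Real.exp_le_exp.2 (by norm_num))
    have h3 := mul_le_mul_of_nonneg_right h2 (show 0 ≤ (k : ℝ) * Λ by linarith)
    linarith
  · intro j hj hjr hle
    obtain ⟨h1, h2⟩ := tilt_sq_mul (n := n) (r := r) hL0 hj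
    have hj0 : (0 : ℝ) < j := by exact_mod_cast hj
    have ht5 : tilt n r j ≤ 5 := by
      unfold tilt
      rw [div_le_iff₀ hj0]
      linarith
    have hexp5 : Real.exp 5 ≤ 10 ^ 10 := by
      have h3 : Real.exp 1 ≤ 3 := by linarith [Real.exp_one_lt_d9]
      calc Real.exp 5 = Real.exp 1 ^ 5 := by rw [← Real.exp_nat_mul]; norm_num
        _ ≤ 3 ^ 5 := pow_le_pow_left₀ (Real.exp_pos _).le h3 5
        _ ≤ _ := by norm_num
    have h3 : j * (ε * Real.exp 5) ≤ 1 := by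
      have hjr' : (j : ℝ) ≤ r := by exact_mod_cast hjr
      calc j * (ε * Real.exp 5) ≤ r * (ε * 10 ^ 10) :=
            mul_le_mul hjr' (mul_le_mul_of_nonneg_left hexp5 hε0) (by positivity) hr0.le
        _ = (ε * r) * 10 ^ 10 := by ring
        _ ≤ 1 / 10 ^ 10 * 10 ^ 10 := mul_le_mul_of_nonneg_right hεr1 (by norm_num)
        _ = 1 := by norm_num
    unfold barrier
    rw [← Real.exp_nat_mul]
    calc Real.exp (j * (25 * tilt n r j ^ 2 / 204 + ε * Real.exp 5)) * (n : ℝ) ^ 2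
        ≤ Real.exp ((6 - 51 / 50 * L) + tilt n r j * (margin n r j - 1)) * (n : ℝ) ^ 2 := by
          refine mul_le_mul_of_nonneg_right (Real.exp_le_exp.2 ?_) (by positivity)
          rw [mul_add, mul_sub, h1, h2]
          linarith
      _ = _ := by
          rw [Real.exp_add]
          ring
  · have h1 : r * (4 * n * Real.exp (6 - 51 / 50 * L)) =
        4 / 200 * (200 * n * r * Real.exp (-L)) * Real.exp (6 - L / 50) := by
      have : (6 - 51 / 50 * L) = -L + (6 - L / 50) := by ring
      rw [this, Real.exp_add]
      ring
    rw [h1, ← hexpL, ← Real.exp_add, add_neg_cancel, Real.exp_zero]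
    have h2 : Real.exp (6 - L / 50) ≤ Real.exp (-14) := Real.exp_le_exp.2 (by linarith)
    have h3 : Real.exp (-14) ≤ 1 / 15 := by
      rw [Real.exp_neg, one_div]
      refine inv_anti₀ (by norm_num) ?_
      have := Real.add_one_le_exp (14 : ℝ)
      linarith
    linarith
  · have hlen := length_bound (k := k) (n := n) (r := r) (a := a) hk' (by linarith)
      (by
        have : (k : ℝ) ≤ k * n / α := by
          rw [le_div_iff₀ hα0]
          exact mul_le_mul_of_nonneg_left (by linarith) (by linarith)
        linarith)
      (by
        have : (n : ℝ) ≤ k * n / α := by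
          rw [le_div_iff₀ hα0]
          exact (mul_le_of_le_one_right hn0 hα1).trans (le_mul_of_one_le_left hn0 hk')
        linarith) hr1 hra
    rw [← hΛ, ← hL] at hlen
    have hsq := margin_sq (n := n) (r := r) hL0 r
    have hmar0 : 0 ≤ margin n r r := Real.sqrt_nonneg _
    have hmar2 : 2 ≤ margin n r r := by
      refine Real.le_sqrt_of_sq_le ?_
      have := mul_le_mul hr10 (hx.trans hLr) (by norm_num) hr0.le
      linarith
    have h1 : N₀.card * (3 * margin n r r + 2) ≤ 41 * (k * Λ) * (4 * margin n r r) :=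
      mul_le_mul hm (by linarith) (by linarith) (by linarith)
    refine h1.trans ?_
    refine abs_le_of_sq_le_sq' ?_ (by linarith) |>.2
    have e : (41 * (k * Λ) * (4 * margin n r r)) ^ 2 =
        13448 * (k ^ 2 * (Λ ^ 2 * L)) * r := by
      have : (41 * (k * Λ) * (4 * margin n r r)) ^ 2 = 26896 * (k ^ 2 * Λ ^ 2) * margin n r r ^ 2 := by
        ring
      rw [this, hsq]
      ring
    rw [e]
    have h2 : 13448 * (k ^ 2 * (Λ ^ 2 * L)) ≤ (1 / 500) ^ 2 * r := by
      have : 0 ≤ (k : ℝ) ^ 2 * (Λ ^ 2 * L) := by positivity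
      linarith
    calc 13448 * (k ^ 2 * (Λ ^ 2 * L)) * r ≤ (1 / 500) ^ 2 * r * r :=
          mul_le_mul_of_nonneg_right h2 hr0.le
      _ = _ := by ring

end Constants

end SketchAttack

end

theorem theorem7p1 :
    ∃ c₀ : ℝ, 0 < c₀ ∧ ∃ C : ℝ, 0 < C ∧ ∃ p : ℕ,
      ∀ (k n r : ℕ) (α δ : ℝ) (ν : Measure ℝ) [IsProbabilityMeasure ν] [NullSingletonClass ν],
        1 ≤ k → 0 < α → α ≤ 1 → 0 ≤ δ → δ ≤ c₀ / Real.sqrt k →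
        C * (k * Real.log (k * r) / α) ≤ n →
        C * ((k : ℝ) ^ 2 / α ^ 2 * Real.log (k * n / α + 2) ^ p) ≤ r →
          SketchAttack.AttackSucceeds (SketchAttack.kMinsLaw k n ν) SketchAttack.kMins α δ r ∧
          SketchAttack.AttackSucceeds (SketchAttack.bottomKLaw n ν) (SketchAttack.bottomK k) α δ r ∧
          SketchAttack.AttackSucceeds (SketchAttack.kPartitionLaw k n ν) SketchAttack.kPartition
            α δ r := by
  refine ⟨1 / 1000, by norm_num, Real.exp 2000, Real.exp_pos _, 3, ?_⟩
  intro k n r α δ ν _ _ hk hα0 hα1 hδ hδ1 hn hr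
  have := SketchAttack.isProbabilityMeasure_kPartitionLaw hk n ν
  refine ⟨SketchAttack.attackSucceeds_of_forall fun h qr => ?_,
    SketchAttack.attackSucceeds_of_forall fun h qr => ?_,
    SketchAttack.attackSucceeds_of_forall fun ρ qr => ?_⟩
  · exact SketchAttack.le_successProb_of_exists_determines hk hα0 hα1 hδ hδ1 hn hr
      (SketchAttack.exists_determines_kMins h) qr
  · exact SketchAttack.le_successProb_of_exists_determines hk hα0 hα1 hδ hδ1 hn hr
      (SketchAttack.exists_determines_bottomK h) qr
  · exact SketchAttack.le_successProb_of_exists_determines hk hα0 hα1 hδ hδ1 hn hr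
      (SketchAttack.exists_determines_kPartition ρ) qr
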